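/- Let $\Theta=[-1/2,1/2]$, let $\theta_0\in\Theta$, and let $f:\Theta\to\mathbb R$ be continuous on $\Theta$ and differentiable on $\Theta\setminus\{\theta_0\}$ (one-sidedly at the end points). Put $\alpha_0=\max_{t\in\Theta}|f(t)|$ and $\alpha_1=\sup_{t\in\Theta\setminus\{\theta_0\}}|f'(t)|\in[0,\infty]$. The source experiment $\mathcal U(\cdot|\theta)$ is the uniform distribution on $[\theta-1/2,\theta+1/2]$, and the target experiment $\mathcal V(\cdot|\theta)$ is $\mathcal N(f(\theta),\sigma^2)$, with density $v(y;\theta)$, $\theta\in\Theta$. Let $g(y)=v(y;1/2)+v(y;-1/2)-v(y;\theta_0)$ and define the signed kernel $$\mathcal S^*(y|x)=\begin{cases} g(y) & x\le\theta_0-1/2,\\ g(y)-\nabla_\theta v(y;\theta)|_{\theta=x+1/2} & \theta_0-1/2<x\le 0,\\ \nabla_\theta v(y;\theta)|_{\theta=x-1/2}+g(y) & 0<x<\theta_0+1/2,\\ g(y) & x\ge\theta_0+1/2\end{cases}$$ (the first case that applies is used). For every $x$ let $\mathcal P(\cdot|x)$ be the density of $\mathcal N(0,2\sigma^2)$. Algorithm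 $\textsc{rk}(x,N,M,y_0)$: initialize $t=0$, $Y=y_0$, and mark $Y$ "unset". Until $Y$ is set or $t\ge N+1$: draw $U_t\sim\mathrm{Unif}([0,1])$ and $Y_t\sim\mathcal P(\cdot|x)$ independently of each other and of the past; if $U_t\le \frac1M\cdot\frac{\mathcal S^*(Y_t|x)\vee 0}{\mathcal P(Y_t|x)}$, set $Y\gets Y_t$; then $t\gets t+1$. Output $Y$. Write $\|\mu-\nu\|_{\mathsf{TV}}=\sup_C|\mu(C)-\nu(C)|$, and let $X_\theta\sim\mathcal U(\cdot|\theta)$ be independent of the random draws of the algorithm. Then for every $\epsilon\in(0,1)$, every $\sigma>0$ with $\sigma\ge 40\max\{\alpha_0,\alpha_1\}$ and every $y_0\in\mathbb R$, the algorithm $\textsc{rk}$ with $M=30$ and $N=60\log(4/\epsilon)$ defines a Markov kernel $x\mapsto\mathcal L[\textsc{rk}(x,N,M,y_0)]$ and satisfies, for every $\theta\in\Theta$, $$\big\|\mathcal L[\textsc{rk}(X_\theta,N,M,y_0)]-\mathcal N(f(\theta),\sigma^2)\big\|_{\mathsf{TV}}\le\frac\epsilon2+10\exp\Big\{-\frac{\sigma^2}{200\alpha_1^2}\Big\},$$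 where the exponential is $0$ if $\alpha_1=0$. Consequently, if in addition $\sigma\ge 10\alpha_1\sqrt{2\log(20/\epsilon)}$, then the deficiency $$\delta(\mathcal U,\mathcal V;\textsc{rk})=\sup_{\theta\in\Theta}\Big\|\mathcal V(\cdot|\theta)-\int\mathcal L[\textsc{rk}(x,N,M,y_0)]\,\mathcal U(dx|\theta)\Big\|_{\mathsf{TV}}$$ is at most $\epsilon$. Moreover, if a draw from $\mathcal P(\cdot|x)$ takes time $T_{samp}\ge1$, an evaluation of $\mathcal S^*$ at a point takes time $T_{eval}\ge1$, and every elementary operation (assignment, comparison, real arithmetic, draw from $\mathrm{Unif}([0,1])$, evaluation of the Gaussian density $\mathcal P$) takes one unit of time, then on every input and for every outcome of the random draws $\textsc{rk}$ runs in time at most $K\log(4/\epsilon)\,(T_{samp}+T_{eval})$, where $K$ is a universal constant. -/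

import Mathlib

open MeasureTheory ProbabilityTheory
open scoped ENNReal NNReal

noncomputable section

namespace RejectionKernel

/-- Total variation distance `sup_C |μ C - ν C|`, the supremum over all measurable sets `C`. -/
def tvDist {Y : Type*} [MeasurableSpace Y] (μ ν : Measure Y) : ℝ≥0∞ :=
  ⨆ (C : Set Y) (_ : MeasurableSet C), ENNReal.ofReal |μ.real C - ν.real C|

/-- The deficiency attained by the kernel `T` when it maps the source experiment `U` to the
target experiment `V`: the supremum over the parameters of the total variation distance
between `V(· | θ)` and `∫ T(· | x) U(dx | θ)`. -/
def deficiency {Θ X Y : Type*} [MeasurableSpace X] [MeasurableSpace Y]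
    (U : Θ → Measure X) (V : Θ → Measure Y) (T : Kernel X Y) : ℝ≥0∞ :=
  ⨆ θ : Θ, tvDist (V θ) ((U θ).bind T)

/-! ### The randomized algorithm `rk(x, N, M, y₀)` -/

/-- The state of the algorithm: the number `t` of elapsed iterations, the current value `Y` and
its mark, followed by a record of the work done so far: the number of draws from the base
measure, of evaluations of the signed kernel, and of elementary operations (assignments,
comparisons, arithmetic operations, draws from the uniform distribution on `[0,1]`, and
evaluations of the explicit base density). -/
structure RKState where
  t : ℕ
  Y : ℝ
  isSet : Bool
  numSamp : ℕ
  numEval : ℕ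
  numElem : ℕ

/-- Start: `t = 0`, `Y = y₀`, marked "unset" (three assignments). -/
def rkInit (y₀ : ℝ) : RKState where
  t := 0
  Y := y₀
  isSet := false
  numSamp := 0
  numEval := 0
  numElem := 3

/-- One iteration, with `uy = (U_t, Y_t)` the fresh draws: one uniform draw, one draw from the base
measure, one evaluation of `S(Y_t | x)`. If `U_t ≤ (1/M) · (S(Y_t|x) ∨ 0)/p(Y_t|x)` (one evaluation
of `p`, one maximum, two divisions, one comparison) then `Y ← Y_t` and `Y` is marked "set" (two
assignments). Finally `t ← t + 1` (one operation). -/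
def rkIter (S p : ℝ → ℝ → ℝ) (M x : ℝ) (uy : ℝ × ℝ) (s : RKState) : RKState :=
  open Classical in
  if uy.1 ≤ 1 / M * (max (S uy.2 x) 0 / p uy.2 x) then
    { t := s.t + 1
      Y := uy.2
      isSet := true
      numSamp := s.numSamp + 1
      numEval := s.numEval + 1
      numElem := s.numElem + 9 }
  else
    { t := s.t + 1
      Y := s.Y
      isSet := s.isSet
      numSamp := s.numSamp + 1
      numEval := s.numEval + 1
      numElem := s.numElem + 7 }

/-- The loop "until `Y` is set or `t ≥ N + 1`", unrolled `fuel` times. The test of the loop condition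
costs three elementary operations (a look-up of the mark, one addition, one comparison). The draws
used in iteration `t` are the entry `ω t` of the random tape. -/
def rkLoop (S p : ℝ → ℝ → ℝ) (N M x : ℝ) (ω : ℕ → ℝ × ℝ) : ℕ → RKState → RKState
  | 0, s => s
  | fuel + 1, s =>
      open Classical in
      if s.isSet = true ∨ N + 1 ≤ (s.t : ℝ) then s
      else rkLoop S p N M x ω fuel
        (rkIter S p M x (ω s.t) { s with numElem := s.numElem + 3 })

/-- The final state on the random tape `ω`. After at most `⌈N + 1⌉₊` iterations the loop
condition fails (see `rkFinal_halted`). -/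
def rkFinal (S p : ℝ → ℝ → ℝ) (N M y₀ x : ℝ) (ω : ℕ → ℝ × ℝ) : RKState :=
  rkLoop S p N M x ω ⌈N + 1⌉₊ (rkInit y₀)

theorem rkIter_t (S p : ℝ → ℝ → ℝ) (M x : ℝ) (uy : ℝ × ℝ) (s : RKState) :
    (rkIter S p M x uy s).t = s.t + 1 := by
  unfold rkIter
  split_ifs <;> rfl

theorem rkLoop_halted (S p : ℝ → ℝ → ℝ) (N M x : ℝ) (ω : ℕ → ℝ × ℝ) (fuel : ℕ) (s : RKState)
    (h : N + 1 ≤ (s.t : ℝ) + fuel) :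
    (rkLoop S p N M x ω fuel s).isSet = true ∨
      N + 1 ≤ ((rkLoop S p N M x ω fuel s).t : ℝ) := by
  induction fuel generalizing s with
  | zero => right; simpa [rkLoop] using h
  | succ k ih =>
    unfold rkLoop
    split_ifs with hs
    · exact hs
    · apply ih
      rw [rkIter_t]
      push_cast at h ⊢
      linarith

/-- The unrolling is long enough: the final state satisfies the exit condition of the loop. -/
theorem rkFinal_halted (S p : ℝ → ℝ → ℝ) (N M y₀ x : ℝ) (ω : ℕ → ℝ × ℝ) :
    (rkFinal S p N M y₀ x ω).isSet = true ∨
      N + 1 ≤ ((rkFinal S p N M y₀ x ω).t : ℝ) := by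
  apply rkLoop_halted
  simpa [rkInit] using Nat.le_ceil (N + 1)

/-- The output of the algorithm on input `x` and random tape `ω`. -/
def rkOutput (S p : ℝ → ℝ → ℝ) (N M y₀ x : ℝ) (ω : ℕ → ℝ × ℝ) : ℝ :=
  (rkFinal S p N M y₀ x ω).Y

/-- The running time on input `x` and random tape `ω`, when an elementary operation takes one unit
of time, a draw from the base measure `Tsamp` and an evaluation of `S` at a point `Teval` units.
The test of the loop condition that ends the loop and the output step add four operations. -/
def rkTime (S p : ℝ → ℝ → ℝ) (N M y₀ Tsamp Teval x : ℝ) (ω : ℕ → ℝ × ℝ) : ℝ :=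
  let s := rkFinal S p N M y₀ x ω
  s.numSamp * Tsamp + s.numEval * Teval + (s.numElem + 4)

/-- The law of the random tape: independent pairs `(U_t, Y_t)`, where `U_t` is uniform on `[0,1]` and
`Y_t` is independent of `U_t` with density `p(· | x)`. -/
def tapeLaw (p : ℝ → ℝ → ℝ) (x : ℝ) : Measure (ℕ → ℝ × ℝ) :=
  Measure.infinitePi fun _ : ℕ =>
    ((volume : Measure ℝ).restrict (Set.Icc 0 1)).prod
      ((volume : Measure ℝ).withDensity fun y => ENNReal.ofReal (p y x))

/-- The law of `rk(x, N, M, y₀)`. -/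
def rkLaw (S p : ℝ → ℝ → ℝ) (N M y₀ x : ℝ) : Measure ℝ :=
  (tapeLaw p x).map (rkOutput S p N M y₀ x)

/-! ### The source and target experiments and the signed kernel -/

/-- The parameter space `[-1/2, 1/2]`. -/
def Θ : Set ℝ := Set.Icc (-1 / 2) (1 / 2)

/-- The uniform location model: Lebesgue measure on `[θ - 1/2, θ + 1/2]`. -/
def uniformSource (θ : ℝ) : Measure ℝ :=
  (volume : Measure ℝ).restrict (Set.Icc (θ - 1 / 2) (θ + 1 / 2))

/-- The density `v(y; θ)` of `N(f(θ), σ²)`. -/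
def targetDensity (f : ℝ → ℝ) (σ y θ : ℝ) : ℝ :=
  gaussianPDFReal (f θ) (σ ^ 2).toNNReal y

/-- The target experiment `N(f(θ), σ²)`. -/
def gaussianTarget (f : ℝ → ℝ) (σ θ : ℝ) : Measure ℝ :=
  gaussianReal (f θ) (σ ^ 2).toNNReal

/-- The base density `P(y | x)`: the density of `N(0, 2σ²)` for every `x`. -/
def baseDensity (σ y _x : ℝ) : ℝ :=
  gaussianPDFReal 0 (2 * σ ^ 2).toNNReal y

/-- `g⁺(y) = g⁻(y) = v(y; 1/2) + v(y; -1/2) - v(y; θ₀)`. -/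
def gFun (f : ℝ → ℝ) (θ₀ σ y : ℝ) : ℝ :=
  targetDensity f σ y (1 / 2) + targetDensity f σ y (-1 / 2) - targetDensity f σ y θ₀

/-- `∇_θ v(y; θ)` on the parameter space (one-sided at the two end points). -/
def gradTarget (f : ℝ → ℝ) (σ y θ : ℝ) : ℝ :=
  derivWithin (fun θ' => targetDensity f σ y θ') Θ θ

/-- The signed kernel `S*(y | x)`. -/
def signedKernel (f : ℝ → ℝ) (θ₀ σ y x : ℝ) : ℝ :=
  open Classical in
  if x ≤ θ₀ - 1 / 2 then gFun f θ₀ σ y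
  else if -1 / 2 + θ₀ < x ∧ x ≤ 0 then gFun f θ₀ σ y - gradTarget f σ y (x + 1 / 2)
  else if 0 < x ∧ x < 1 / 2 + θ₀ then gradTarget f σ y (x - 1 / 2) + gFun f θ₀ σ y
  else gFun f θ₀ σ y

/-- `α₀ = max |f|` over the parameter space. -/
def alpha0 (f : ℝ → ℝ) : ℝ≥0∞ :=
  ⨆ t ∈ Θ, ENNReal.ofReal |f t|

/-- `α₁ = sup |f'|` over the parameter space without `θ₀`; it is `∞` if `f'` is unbounded. -/
def alpha1 (f : ℝ → ℝ) (θ₀ : ℝ) : ℝ≥0∞ :=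
  ⨆ t ∈ Θ \ {θ₀}, ENNReal.ofReal |derivWithin f Θ t|

/-- `exp(-σ² / (200 α₁²))`, computed in the extended reals: it is `exp(-∞) = 0` if `α₁ = 0 < σ`. -/
def expTail (σ : ℝ) (α₁ : ℝ≥0∞) : ℝ≥0∞ :=
  EReal.exp (-((ENNReal.ofReal σ ^ 2 / (200 * α₁ ^ 2) : ℝ≥0∞) : EReal))

end RejectionKernel

end

noncomputable section

namespace RejectionKernel

/-! ### The law of the algorithm -/

/-! The signed kernel reproduces the target exactly. Every source interval `[θ - 1/2, θ + 1/2]`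
contains `0`; integrating `S*(y|x) - g(y)` over it, the gradients on the two sides of `0` telescope
to `v(max θ θ₀) - v(1/2)` and `v(min θ θ₀) - v(-1/2)`. Adding `g(y)` leaves `v(y;θ)`
(`integral_signedKernel_source`). The kernel has total mass one in `y`, because `∇_θ v` integrates
to zero (`integral_signedKernel`).

It fails to be a density only where it is negative. With `A = α₁`, on `A|y| ≤ 0.15 σ²` the values
`v(y;·)` are comparable with each other and dominate the gradient, so `S* ≥ 0` there
(`signedKernel_nonneg`). The complement is a Gaussian tail event under the base law, so the negative
part has mass at most `3 exp(-σ²/(200 A²))` (`integral_negPart_le`).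

Since `S* ≤ 3P` (`signedKernel_le`), rejection with `M = 30` is legitimate: an accepted draw has
density proportional to `S* ∨ 0`, and each round accepts with probability at least `1/30`. Thus for
every `x` the output law differs from `S*(·|x)` by at most the probability that all rounds fail plus
the negative mass (`abs_rkLaw_sub_le`). Averaging over `x` gives the bound. -/

/-- The pairs `(u, y)` that the algorithm accepts on input `x`. -/
def acceptSet (S p : ℝ → ℝ → ℝ) (M x : ℝ) : Set (ℝ × ℝ) :=
  {uy | uy.1 ≤ 1 / M * (max (S uy.2 x) 0 / p uy.2 x)}

theorem rkLoop_of_isSet (S p : ℝ → ℝ → ℝ) (N M x : ℝ) (ω : ℕ → ℝ × ℝ) (fuel : ℕ) (s : RKState)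
    (hs : s.isSet = true) : rkLoop S p N M x ω fuel s = s := by
  cases fuel with
  | zero => rfl
  | succ k => unfold rkLoop; rw [if_pos (Or.inl hs)]

/-- The state after a rejected iteration. -/
def rejectState (s : RKState) : RKState where
  t := s.t + 1
  Y := s.Y
  isSet := s.isSet
  numSamp := s.numSamp + 1
  numEval := s.numEval + 1
  numElem := s.numElem + 3 + 7

open Classical in
theorem rkLoop_succ_Y (S p : ℝ → ℝ → ℝ) (N M x : ℝ) (ω : ℕ → ℝ × ℝ) (fuel : ℕ) (s : RKState)
    (hs : s.isSet = false) (ht : (s.t : ℝ) < N + 1) :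
    (rkLoop S p N M x ω (fuel + 1) s).Y =
      if ω s.t ∈ acceptSet S p M x then (ω s.t).2
      else (rkLoop S p N M x ω fuel (rejectState s)).Y := by
  rw [rkLoop, if_neg (by simp [hs, ht])]
  by_cases h : ω s.t ∈ acceptSet S p M x
  · rw [rkIter, if_pos h, if_pos (show _ ≤ _ from h), rkLoop_of_isSet _ _ _ _ _ _ _ _ rfl]
  · rw [rkIter, if_neg h, if_neg (show ¬ _ ≤ _ from h)]
    rfl

theorem measurable_rkLoop_Y {S p : ℝ → ℝ → ℝ} {M x : ℝ} (N : ℝ)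
    (hA : MeasurableSet (acceptSet S p M x)) (fuel : ℕ) (s : RKState) (hs : s.isSet = false) :
    Measurable fun ω => (rkLoop S p N M x ω fuel s).Y := by
  classical
  induction fuel generalizing s with
  | zero => simp only [rkLoop, measurable_const]
  | succ k ih =>
    by_cases ht : (s.t : ℝ) < N + 1
    · simp_rw [rkLoop_succ_Y S p N M x _ k s hs ht]
      exact Measurable.ite (hA.preimage (measurable_pi_apply s.t))
        (measurable_snd.comp (measurable_pi_apply s.t)) (ih _ hs)
    · have h (ω) : rkLoop S p N M x ω (k + 1) s = s := by
        rw [rkLoop, if_pos (Or.inr (not_lt.1 ht))]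
      simp_rw [h]
      exact measurable_const

theorem measurable_rkOutput {S p : ℝ → ℝ → ℝ} {M x : ℝ} (N y₀ : ℝ)
    (hA : MeasurableSet (acceptSet S p M x)) : Measurable (rkOutput S p N M y₀ x) :=
  measurable_rkLoop_Y N hA _ _ rfl

/-- On a tape of independent draws with law `ν`, the event that the first `s.t` draws are rejected
and the loop, started in the unset state `s`, ends with a value in `C`. -/
theorem infinitePi_rkLoop {S p : ℝ → ℝ → ℝ} {N M x : ℝ} (hA : MeasurableSet (acceptSet S p M x))
    (ν : Measure (ℝ × ℝ)) [IsProbabilityMeasure ν] {C : Set ℝ} (hC : MeasurableSet C) (fuel : ℕ)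
    (s : RKState) (hs : s.isSet = false) (ht : s.t + fuel = ⌈N + 1⌉₊) :
    Measure.infinitePi (fun _ : ℕ => ν)
        (Set.pi (Finset.range s.t : Set ℕ) (fun _ => (acceptSet S p M x)ᶜ) ∩
          {ω | (rkLoop S p N M x ω fuel s).Y ∈ C}) =
      ν (acceptSet S p M x)ᶜ ^ s.t *
        (∑ k ∈ Finset.range fuel, ν (acceptSet S p M x)ᶜ ^ k *
            ν (acceptSet S p M x ∩ Prod.snd ⁻¹' C) +
          ν (acceptSet S p M x)ᶜ ^ fuel * Set.indicator C 1 s.Y) := by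
  classical
  set A := acceptSet S p M x
  have hE (n : ℕ) : Measure.infinitePi (fun _ : ℕ => ν)
      (Set.pi (Finset.range n : Set ℕ) (fun _ => Aᶜ)) = ν Aᶜ ^ n := by
    rw [Measure.infinitePi_pi _ fun _ _ => hA.compl]
    simp
  -- Keeping the rejected prefix inside the event replaces conditioning on the past, so the tape
  -- never has to be shifted.
  induction fuel generalizing s with
  | zero =>
    by_cases h : s.Y ∈ C
    · simp [rkLoop, h, ← hE]
    · simp [rkLoop, h]
  | succ n ih =>
    -- Counter and fuel add up to `⌈N + 1⌉₊`, so the counter cannot stop the loop while fuel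
    -- remains.
    have hlt : (s.t : ℝ) < N + 1 := by
      rw [← Nat.lt_ceil]
      omega
    -- Split on whether draw `s.t` is accepted: the first piece is a finite box, the second is the
    -- event of the induction hypothesis at `rejectState s`.
    have hsplit : Set.pi (Finset.range s.t : Set ℕ) (fun _ => Aᶜ) ∩
          {ω | (rkLoop S p N M x ω (n + 1) s).Y ∈ C} =
        Set.pi (Finset.range (s.t + 1) : Set ℕ)
            (fun i => if i = s.t then A ∩ Prod.snd ⁻¹' C else Aᶜ) ∪
          (Set.pi (Finset.range (s.t + 1) : Set ℕ) (fun _ => Aᶜ) ∩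
            {ω | (rkLoop S p N M x ω n (rejectState s)).Y ∈ C}) := by
      ext ω
      simp only [Set.mem_inter_iff, Set.mem_pi, Finset.coe_range, Set.mem_Iio, Set.mem_ofPred_eq,
        Set.mem_union, Order.lt_add_one_iff, rkLoop_succ_Y S p N M x ω n s hs hlt]
      by_cases h : ω s.t ∈ A
      · rw [if_pos h]
        constructor
        · rintro ⟨h1, h2⟩
          refine Or.inl fun i hi => ?_
          rcases hi.lt_or_eq with hi | rfl
          · rw [if_neg hi.ne]; exact h1 i hi
          · rw [if_pos rfl]; exact ⟨h, h2⟩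
        · rintro (h1 | ⟨h1, -⟩)
          · refine ⟨fun i hi => ?_, ?_⟩
            · simpa [hi.ne] using h1 i hi.le
            · have := h1 s.t le_rfl
              rw [if_pos rfl] at this
              exact this.2
          · exact absurd h (h1 s.t le_rfl)
      · rw [if_neg h]
        constructor
        · rintro ⟨h1, h2⟩
          refine Or.inr ⟨fun i hi => ?_, h2⟩
          rcases hi.lt_or_eq with hi | rfl
          · exact h1 i hi
          · exact h
        · rintro (h1 | ⟨h1, h2⟩)
          · have := h1 s.t le_rfl
            rw [if_pos rfl] at this
            exact absurd this.1 h
          · exact ⟨fun i hi => h1 i hi.le, h2⟩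
    have hm : ∀ i, MeasurableSet (if i = s.t then A ∩ Prod.snd ⁻¹' C else Aᶜ) := fun i => by
      split_ifs
      · exact hA.inter (measurable_snd hC)
      · exact hA.compl
    rw [hsplit, measure_union', Measure.infinitePi_pi _ fun i _ => hm i,
      show Finset.range (s.t + 1) = Finset.range (rejectState s).t from rfl,
      ih (rejectState s) hs (by simp only [rejectState]; omega)]
    · simp only [rejectState]
      rw [Finset.prod_range_succ, if_pos rfl,
        Finset.prod_congr rfl (g := fun _ => ν Aᶜ) fun i hi => by
          rw [if_neg (Finset.mem_range.1 hi).ne], Finset.prod_const, Finset.card_range,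
        Finset.sum_range_succ', ← Finset.sum_mul, ← Finset.sum_mul]
      simp only [pow_succ, pow_zero, ← Finset.sum_mul]
      ring
    · rw [Set.disjoint_left]
      rintro ω h1 ⟨h2, -⟩
      have h1' := h1 s.t (by simp)
      simp only [if_true] at h1'
      exact h2 s.t (by simp) h1'.1
    · exact MeasurableSet.pi (Set.to_countable _) fun i _ => hm i

/-- The law of the algorithm is a mixture of the law of an accepted draw and of `y₀`. -/
theorem rkLaw_apply {S p : ℝ → ℝ → ℝ} {M x : ℝ} (N y₀ : ℝ)
    (hA : MeasurableSet (acceptSet S p M x)) {ν : Measure (ℝ × ℝ)} [IsProbabilityMeasure ν]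
    (hν : ((volume : Measure ℝ).restrict (Set.Icc 0 1)).prod
      ((volume : Measure ℝ).withDensity fun y => ENNReal.ofReal (p y x)) = ν)
    {C : Set ℝ} (hC : MeasurableSet C) :
    rkLaw S p N M y₀ x C =
      ∑ k ∈ Finset.range ⌈N + 1⌉₊, ν (acceptSet S p M x)ᶜ ^ k *
          ν (acceptSet S p M x ∩ Prod.snd ⁻¹' C) +
        ν (acceptSet S p M x)ᶜ ^ ⌈N + 1⌉₊ * Set.indicator C 1 y₀ := by
  rw [rkLaw, Measure.map_apply (measurable_rkOutput N y₀ hA) hC, tapeLaw, hν,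
    show rkOutput S p N M y₀ x ⁻¹' C =
      {ω | (rkLoop S p N M x ω ⌈N + 1⌉₊ (rkInit y₀)).Y ∈ C} from rfl]
  have := infinitePi_rkLoop (N := N) hA ν hC ⌈N + 1⌉₊ (rkInit y₀) rfl (by simp [rkInit])
  simpa only [rkInit, Finset.range_zero, Finset.coe_empty, Set.empty_pi, Set.univ_inter, pow_zero,
    one_mul] using this

/-- If the acceptance ratio does not exceed `1`, an accepted draw has density `(S ∨ 0) / M`. -/
theorem prod_acceptSet {S p : ℝ → ℝ → ℝ} {M x : ℝ} (hM : 0 < M)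
    (hS : Measurable fun y => S y x) (hp : Measurable fun y => p y x) (hpos : ∀ y, 0 < p y x)
    (hle : ∀ y, max (S y x) 0 ≤ M * p y x) (hA : MeasurableSet (acceptSet S p M x))
    {C : Set ℝ} (hC : MeasurableSet C) :
    (((volume : Measure ℝ).restrict (Set.Icc 0 1)).prod
      ((volume : Measure ℝ).withDensity fun y => ENNReal.ofReal (p y x)))
        (acceptSet S p M x ∩ Prod.snd ⁻¹' C) =
      ∫⁻ y in C, ENNReal.ofReal (max (S y x) 0 / M) := by
  have hpm : Measurable fun y => ENNReal.ofReal (p y x) := hp.ennreal_ofReal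
  have hrm : Measurable fun y => ENNReal.ofReal (1 / M * (max (S y x) 0 / p y x)) :=
    (((hS.max measurable_const).div hp).const_mul _).ennreal_ofReal
  rw [Measure.prod_apply_symm (hA.inter (measurable_snd hC))]
  have h1 (y : ℝ) : (volume : Measure ℝ).restrict (Set.Icc 0 1)
        ((fun u => (u, y)) ⁻¹' (acceptSet S p M x ∩ Prod.snd ⁻¹' C)) =
      C.indicator (fun y => ENNReal.ofReal (1 / M * (max (S y x) 0 / p y x))) y := by
    by_cases hy : y ∈ C
    · rw [Set.indicator_of_mem hy, Measure.restrict_apply' measurableSet_Icc]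
      have hr1 : 1 / M * (max (S y x) 0 / p y x) ≤ 1 := by
        rw [div_mul_div_comm, one_mul, div_le_one (mul_pos hM (hpos y))]
        exact hle y
      -- As the ratio is at most `1`, the uniform variable accepts with probability equal to the
      -- ratio, without truncation.
      have : (fun u => (u, y)) ⁻¹' (acceptSet S p M x ∩ Prod.snd ⁻¹' C) ∩ Set.Icc 0 1 =
          Set.Icc 0 (1 / M * (max (S y x) 0 / p y x)) := by
        ext u
        simp only [acceptSet, Set.mem_inter_iff, Set.mem_preimage, Set.mem_ofPred_eq, Set.mem_Icc]
        constructor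
        · rintro ⟨⟨h, -⟩, h0, -⟩
          exact ⟨h0, h⟩
        · rintro ⟨h0, h⟩
          exact ⟨⟨h, hy⟩, h0, h.trans hr1⟩
      rw [this, Real.volume_Icc, sub_zero]
    · rw [Set.indicator_of_notMem hy]
      have : (fun u => (u, y)) ⁻¹' (acceptSet S p M x ∩ Prod.snd ⁻¹' C) = (∅ : Set ℝ) := by
        ext u
        simp [hy]
      rw [this, measure_empty]
  simp_rw [h1]
  rw [lintegral_indicator hC, setLIntegral_withDensity_eq_setLIntegral_mul _ hpm hrm hC]
  refine lintegral_congr fun y => ?_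
  rw [Pi.mul_apply, ← ENNReal.ofReal_mul (hpos y).le]
  congr 1
  have := (hpos y).ne'
  field_simp

/-! ### The running time -/

/-- The `12` is `3` for the loop test plus at most `9` for the iteration. -/
theorem rkLoop_counts (S p : ℝ → ℝ → ℝ) (N M x : ℝ) (ω : ℕ → ℝ × ℝ) (fuel : ℕ) (s : RKState) :
    (rkLoop S p N M x ω fuel s).numSamp ≤ s.numSamp + fuel ∧
      (rkLoop S p N M x ω fuel s).numEval ≤ s.numEval + fuel ∧
      (rkLoop S p N M x ω fuel s).numElem ≤ s.numElem + 12 * fuel := by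
  induction fuel generalizing s with
  | zero => simp [rkLoop]
  | succ k ih =>
    unfold rkLoop
    split_ifs with h
    · omega
    · refine (ih _).imp (fun h => h.trans ?_) (And.imp (fun h => h.trans ?_) fun h => h.trans ?_)
      all_goals
        unfold rkIter
        split_ifs <;> simp only <;> omega

theorem rkTime_le (S p : ℝ → ℝ → ℝ) {N Tsamp Teval : ℝ} (M y₀ x : ℝ) (ω : ℕ → ℝ × ℝ)
    (hN : 0 ≤ N) (hs : 1 ≤ Tsamp) (he : 1 ≤ Teval) :
    rkTime S p N M y₀ Tsamp Teval x ω ≤ 7 * (N + 3) * (Tsamp + Teval) := by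
  obtain ⟨h1, h2, h3⟩ := rkLoop_counts S p N M x ω ⌈N + 1⌉₊ (rkInit y₀)
  have hc : (⌈N + 1⌉₊ : ℝ) ≤ N + 2 := by
    have := Nat.ceil_lt_add_one (show 0 ≤ N + 1 by linarith)
    linarith
  simp only [rkInit, zero_add] at h1 h2 h3
  have h1' : ((rkFinal S p N M y₀ x ω).numSamp : ℝ) ≤ N + 2 := le_trans (by exact_mod_cast h1) hc
  have h2' : ((rkFinal S p N M y₀ x ω).numEval : ℝ) ≤ N + 2 := le_trans (by exact_mod_cast h2) hc
  have h3' : ((rkFinal S p N M y₀ x ω).numElem : ℝ) ≤ 3 + 12 * (N + 2) := by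
    have : ((rkFinal S p N M y₀ x ω).numElem : ℝ) ≤ 3 + 12 * (⌈N + 1⌉₊ : ℝ) := by exact_mod_cast h3
    linarith
  simp only [rkTime]
  have := mul_le_mul_of_nonneg_right h1' (zero_le_one.trans hs)
  have := mul_le_mul_of_nonneg_right h2' (zero_le_one.trans he)
  -- The elementary operations are absorbed using `Tsamp + Teval ≥ 2`.
  nlinarith

end RejectionKernel

namespace RejectionKernel

/-! ### Calculus on the parameter space -/

theorem uniqueDiffOn_Θ : UniqueDiffOn ℝ Θ := uniqueDiffOn_Icc (by norm_num)

/-- No regularity of `F` is needed: in the interior this is `deriv F`, which is always measurable,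
and only two end points remain. -/
theorem measurable_indicator_derivWithin (F : ℝ → ℝ) :
    Measurable (Θ.indicator (derivWithin F Θ)) := by
  classical
  have h : Θ.indicator (derivWithin F Θ) = fun t =>
      if t = -1 / 2 then derivWithin F Θ (-1 / 2) else
        if t = 1 / 2 then derivWithin F Θ (1 / 2) else
          (Set.Ioo (-1 / 2) (1 / 2)).indicator (deriv F) t := by
    funext t
    split_ifs with h1 h2
    · subst h1
      rw [Set.indicator_of_mem]
      constructor <;> norm_num
    · subst h2
      rw [Set.indicator_of_mem]
      constructor <;> norm_num
    · by_cases ht : t ∈ Set.Ioo (-1 / 2 : ℝ) (1 / 2)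
      · rw [Set.indicator_of_mem ht, Set.indicator_of_mem (show t ∈ Θ from Set.Ioo_subset_Icc_self ht),
          derivWithin_of_mem_nhds (show Θ ∈ nhds t from Icc_mem_nhds ht.1 ht.2)]
      · rw [Set.indicator_of_notMem ht, Set.indicator_of_notMem]
        rintro ⟨h3, h4⟩
        exact ht ⟨lt_of_le_of_ne h3 (Ne.symm h1), lt_of_le_of_ne h4 h2⟩
  rw [h]
  exact Measurable.ite (measurableSet_singleton _) measurable_const
    (Measurable.ite (measurableSet_singleton _) measurable_const
      ((measurable_deriv F).indicator measurableSet_Ioo))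

/-- The fundamental theorem of calculus on the parameter space, with one exceptional point. -/
theorem integral_derivWithin_Θ {F : ℝ → ℝ} {θ₀ B : ℝ} (hc : ContinuousOn F Θ)
    (hd : ∀ t ∈ Θ \ {θ₀}, DifferentiableWithinAt ℝ F Θ t)
    (hB : ∀ t ∈ Θ \ {θ₀}, |derivWithin F Θ t| ≤ B) {a b : ℝ} (ha : a ∈ Θ) (hb : b ∈ Θ) :
    ∫ t in a..b, derivWithin F Θ t = F b - F a := by
  have hsub : Set.uIcc a b ⊆ Θ := Set.uIcc_subset_Icc ha hb
  refine integral_eq_of_hasDerivAt_off_countable F _ (Set.countable_singleton θ₀) (hc.mono hsub)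
    ?_ ?_
  · rintro t ⟨⟨h1, h2⟩, h3⟩
    have h1' : -1 / 2 < t := lt_of_le_of_lt (le_min ha.1 hb.1) h1
    have h2' : t < 1 / 2 := lt_of_lt_of_le h2 (max_le ha.2 hb.2)
    exact ((hd t ⟨⟨h1'.le, h2'.le⟩, h3⟩).hasDerivWithinAt).hasDerivAt (Icc_mem_nhds h1' h2')
  · rw [intervalIntegrable_iff]
    have hm : Measurable (Θ.indicator (derivWithin F Θ)) := measurable_indicator_derivWithin F
    have heq : Set.EqOn (Θ.indicator (derivWithin F Θ)) (derivWithin F Θ) (Set.uIoc a b) :=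
      fun t ht => Set.indicator_of_mem (hsub (Set.uIoc_subset_uIcc ht)) _
    refine Integrable.mono' (integrableOn_const (C := B) (by simp [Set.uIoc])) ?_ ?_
    · exact (hm.aestronglyMeasurable (μ := volume.restrict (Set.uIoc a b))).congr
        ((ae_restrict_iff' measurableSet_uIoc).2 (Filter.Eventually.of_forall heq))
    · rw [ae_restrict_iff' measurableSet_uIoc]
      filter_upwards [measure_eq_zero_iff_ae_notMem.1 (Real.volume_singleton (a := θ₀))] with t h1 h2
      exact hB t ⟨hsub (Set.uIoc_subset_uIcc h2), h1⟩

/-! ### The standing assumptions -/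

/-- The regression function is continuous, differentiable off `θ₀` with derivative at most `A`, and
small compared to `σ`. -/
structure IsRegular (f : ℝ → ℝ) (θ₀ σ A : ℝ) : Prop where
  mem : θ₀ ∈ Θ
  cont : ContinuousOn f Θ
  diff : ∀ t ∈ Θ \ {θ₀}, DifferentiableWithinAt ℝ f Θ t
  pos : 0 < σ
  abs_f_le : ∀ t ∈ Θ, |f t| ≤ σ / 40
  deriv_le : ∀ t ∈ Θ \ {θ₀}, |derivWithin f Θ t| ≤ A
  nonneg : 0 ≤ A
  le : A ≤ σ / 40

/-! ### Gaussian target and base densities -/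

theorem targetDensity_eq (f : ℝ → ℝ) (σ y θ : ℝ) :
    targetDensity f σ y θ =
      (√(2 * Real.pi * σ ^ 2))⁻¹ * Real.exp (-(y - f θ) ^ 2 / (2 * σ ^ 2)) := by
  rw [targetDensity, gaussianPDFReal, Real.coe_toNNReal _ (sq_nonneg σ)]

theorem targetDensity_nonneg (f : ℝ → ℝ) (σ y θ : ℝ) : 0 ≤ targetDensity f σ y θ :=
  gaussianPDFReal_nonneg _ _ _

theorem sq_toNNReal_ne_zero {σ : ℝ} (hσ : 0 < σ) : (σ ^ 2).toNNReal ≠ 0 := by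
  simp [hσ.ne']

theorem two_mul_sq_toNNReal_ne_zero {σ : ℝ} (hσ : 0 < σ) : (2 * σ ^ 2).toNNReal ≠ 0 := by
  simpa using pow_pos hσ 2

theorem baseDensity_pos {σ : ℝ} (hσ : 0 < σ) (y x : ℝ) : 0 < baseDensity σ y x :=
  gaussianPDFReal_pos _ _ _ (two_mul_sq_toNNReal_ne_zero hσ)

/-- Completing the square. Doubling the base variance leaves the factor `exp(-(y/2 - f θ)²/σ²)`,
which bounds the likelihood ratio and still decays enough to absorb the linear factor in the
gradient. -/
theorem targetDensity_eq_base_mul {f : ℝ → ℝ} {σ : ℝ} (hσ : 0 < σ) (y θ : ℝ) :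
    targetDensity f σ y θ = baseDensity σ y 0 *
      (√2 * Real.exp ((f θ ^ 2 / 2 - (y / 2 - f θ) ^ 2) / σ ^ 2)) := by
  rw [targetDensity_eq, baseDensity, gaussianPDFReal, Real.coe_toNNReal _ (by positivity)]
  have h1 : √(2 * Real.pi * (2 * σ ^ 2)) = √2 * √(2 * Real.pi * σ ^ 2) := by
    rw [← Real.sqrt_mul (by norm_num)]
    congr 1
    ring
  have h2 : -(y - f θ) ^ 2 / (2 * σ ^ 2) =
      -(y - 0) ^ 2 / (2 * (2 * σ ^ 2)) + (f θ ^ 2 / 2 - (y / 2 - f θ) ^ 2) / σ ^ 2 := by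
    field_simp
    ring
  rw [h1, h2, Real.exp_add]
  have : √2 ≠ 0 := by positivity
  have : √(2 * Real.pi * σ ^ 2) ≠ 0 := by positivity
  field_simp

theorem hasDerivWithinAt_targetDensity {f : ℝ → ℝ} {σ θ f' : ℝ} {s : Set ℝ} (hσ : 0 < σ) (y : ℝ)
    (hf : HasDerivWithinAt f f' s θ) :
    HasDerivWithinAt (fun t => targetDensity f σ y t)
      (targetDensity f σ y θ * ((y - f θ) / σ ^ 2) * f') s θ := by
  simp_rw [targetDensity_eq]
  have h := (((((hf.const_sub y).pow 2).neg).div_const (2 * σ ^ 2)).exp).const_mul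
    (√(2 * Real.pi * σ ^ 2))⁻¹
  refine h.congr_deriv ?_
  simp only [Pi.neg_apply, Pi.pow_apply]
  field_simp
  ring

theorem measurable_targetDensity (f : ℝ → ℝ) (σ θ : ℝ) :
    Measurable fun y => targetDensity f σ y θ := measurable_gaussianPDFReal _ _

theorem measurable_gFun (f : ℝ → ℝ) (θ₀ σ : ℝ) : Measurable (gFun f θ₀ σ) :=
  ((measurable_targetDensity f σ _).add (measurable_targetDensity f σ _)).sub
    (measurable_targetDensity f σ _)

theorem integrable_baseDensity (σ x : ℝ) : Integrable fun y => baseDensity σ y x :=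
  integrable_gaussianPDFReal _ _

theorem integrable_targetDensity (f : ℝ → ℝ) (σ θ : ℝ) :
    Integrable fun y => targetDensity f σ y θ := integrable_gaussianPDFReal _ _

theorem integral_targetDensity (f : ℝ → ℝ) {σ : ℝ} (hσ : 0 < σ) (θ : ℝ) :
    ∫ y, targetDensity f σ y θ = 1 :=
  integral_gaussianPDFReal_eq_one _ (sq_toNNReal_ne_zero hσ)

/-- Makes the gradient term vanish in `integral_signedKernel`. -/
theorem integral_targetDensity_mul_sub (f : ℝ → ℝ) {σ : ℝ} (hσ : 0 < σ) (θ : ℝ) :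
    Integrable (fun y => targetDensity f σ y θ * (y - f θ)) ∧
      ∫ y, targetDensity f σ y θ * (y - f θ) = 0 := by
  have hv := sq_toNNReal_ne_zero hσ
  have hi : Integrable (fun y => y - f θ) (gaussianReal (f θ) (σ ^ 2).toNNReal) :=
    ((memLp_id_gaussianReal 1).integrable (by simp)).sub (integrable_const _)
  constructor
  · rw [gaussianReal_of_var_ne_zero _ hv, integrable_withDensity_iff_integrable_smul'
      (measurable_gaussianPDF _ _) (Filter.Eventually.of_forall fun _ => gaussianPDF_lt_top)] at hi
    simpa [toReal_gaussianPDF, targetDensity] using hi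
  · have h := integral_gaussianReal_eq_integral_smul (μ := f θ) (f := fun y => y - f θ) hv
    rw [integral_sub (f := fun y => y) ((memLp_id_gaussianReal 1).integrable (by simp))
      (integrable_const _), integral_id_gaussianReal] at h
    simpa [targetDensity] using h.symm

/-! ### Pointwise bounds and total mass of the signed kernel -/

namespace IsRegular

variable {f : ℝ → ℝ} {θ₀ σ A : ℝ}

/-- The derivative bound integrated across `θ₀`; the parameter interval has length one. -/
theorem abs_sub_le (h : IsRegular f θ₀ σ A) {s t : ℝ} (hs : s ∈ Θ) (ht : t ∈ Θ) :
    |f t - f s| ≤ A := by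
  rw [← integral_derivWithin_Θ h.cont h.diff h.deriv_le hs ht, ← Real.norm_eq_abs]
  refine (intervalIntegral.norm_integral_le_of_norm_le_const_ae (C := A) ?_).trans ?_
  · filter_upwards [measure_eq_zero_iff_ae_notMem.1 (Real.volume_singleton (a := θ₀))] with x h1 h2
    exact h.deriv_le x ⟨Set.uIcc_subset_Icc hs ht (Set.uIoc_subset_uIcc h2), h1⟩
  · refine mul_le_of_le_one_right h.nonneg ?_
    rw [abs_le]
    constructor <;> linarith [hs.1, hs.2, ht.1, ht.2]

theorem gradTarget_eq (h : IsRegular f θ₀ σ A) (y : ℝ) {θ : ℝ} (hθ : θ ∈ Θ \ {θ₀}) :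
    gradTarget f σ y θ =
      targetDensity f σ y θ * ((y - f θ) / σ ^ 2) * derivWithin f Θ θ :=
  (hasDerivWithinAt_targetDensity h.pos y (h.diff θ hθ).hasDerivWithinAt).derivWithin
    (uniqueDiffOn_Θ θ hθ.1)

theorem exp_sq_le (h : IsRegular f θ₀ σ A) {θ : ℝ} (hθ : θ ∈ Θ) :
    √2 * Real.exp (f θ ^ 2 / 2 / σ ^ 2) ≤ 1.42 := by
  have h1 : f θ ^ 2 / 2 / σ ^ 2 ≤ 1 / 3200 := by
    have := sq_le_sq' (neg_le_of_abs_le (h.abs_f_le θ hθ)) (le_of_abs_le (h.abs_f_le θ hθ))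
    have hσ := h.pos
    rw [div_le_iff₀ (by positivity)]
    nlinarith
  have h2 : Real.exp (f θ ^ 2 / 2 / σ ^ 2) ≤ 3200 / 3199 := by
    have := Real.one_sub_le_exp_neg (1 / 3200)
    refine (Real.exp_le_exp.2 h1).trans ?_
    rw [Real.exp_neg] at this
    rw [← inv_inv (Real.exp (1 / 3200))]
    refine (inv_anti₀ (by norm_num) this).trans (by norm_num)
  have h3 : √2 ≤ 1.415 := by
    rw [Real.sqrt_le_left (by norm_num)]
    norm_num
  calc √2 * Real.exp (f θ ^ 2 / 2 / σ ^ 2) ≤ 1.415 * (3200 / 3199) := by gcongr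
    _ ≤ 1.42 := by norm_num

theorem targetDensity_le (h : IsRegular f θ₀ σ A) (y : ℝ) {θ : ℝ} (hθ : θ ∈ Θ) :
    targetDensity f σ y θ ≤ 1.42 * baseDensity σ y 0 := by
  rw [targetDensity_eq_base_mul h.pos, mul_comm]
  refine mul_le_mul_of_nonneg_right (le_trans ?_ (h.exp_sq_le hθ)) (baseDensity_pos h.pos _ _).le
  have := h.pos
  gcongr
  nlinarith [sq_nonneg (y / 2 - f θ)]

theorem abs_gradTarget_le (h : IsRegular f θ₀ σ A) (y : ℝ) {θ : ℝ} (hθ : θ ∈ Θ \ {θ₀}) :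
    |gradTarget f σ y θ| ≤ 0.04 * baseDensity σ y 0 := by
  have hσ := h.pos
  have hp := baseDensity_pos h.pos y 0
  set z := (y / 2 - f θ) / σ with hz
  have h1 : |(y - f θ) / σ| ≤ 2 * |z| + 1 / 40 := by
    have e : (y - f θ) / σ = 2 * z + f θ / σ := by
      rw [hz]
      field_simp
      ring
    rw [e]
    refine (abs_add_le _ _).trans ?_
    rw [abs_mul, abs_two, abs_div (f θ), abs_of_pos hσ]
    have : |f θ| / σ ≤ 1 / 40 := by
      rw [div_le_iff₀ hσ]
      linarith [h.abs_f_le θ hθ.1]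
    linarith
  -- From `exp(z²) ≥ 1 + z² ≥ 2|z|`.
  have h2 : (2 * |z| + 1 / 40) * Real.exp (-z ^ 2) ≤ 41 / 40 := by
    have h3 : 1 + z ^ 2 ≤ Real.exp (z ^ 2) := by linarith [Real.add_one_le_exp (z ^ 2)]
    rw [Real.exp_neg, ← div_eq_mul_inv, div_le_iff₀ (Real.exp_pos _)]
    nlinarith [sq_nonneg (|z| - 1), sq_abs z, sq_nonneg z]
  have h4 : |derivWithin f Θ θ / σ| ≤ 1 / 40 := by
    rw [abs_div, abs_of_pos hσ, div_le_iff₀ hσ]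
    linarith [h.deriv_le θ hθ, h.le]
  have e : (f θ ^ 2 / 2 - (y / 2 - f θ) ^ 2) / σ ^ 2 = f θ ^ 2 / 2 / σ ^ 2 + -z ^ 2 := by
    rw [hz]
    field_simp
    ring
  have e2 : gradTarget f σ y θ = baseDensity σ y 0 *
      ((√2 * Real.exp (f θ ^ 2 / 2 / σ ^ 2)) *
        (((y - f θ) / σ) * Real.exp (-z ^ 2)) * (derivWithin f Θ θ / σ)) := by
    rw [h.gradTarget_eq y hθ, targetDensity_eq_base_mul hσ, e, Real.exp_add]
    field_simp
  rw [e2, abs_mul, abs_of_pos hp, mul_comm]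
  refine mul_le_mul_of_nonneg_right ?_ hp.le
  rw [abs_mul, abs_mul, abs_mul ((y - f θ) / σ), abs_of_pos (Real.exp_pos _),
    abs_of_nonneg (show 0 ≤ √2 * Real.exp (f θ ^ 2 / 2 / σ ^ 2) by positivity)]
  calc _ ≤ 1.42 * ((2 * |z| + 1 / 40) * Real.exp (-z ^ 2)) * (1 / 40) := by
        gcongr
        exact h.exp_sq_le hθ.1
    _ ≤ 1.42 * (41 / 40) * (1 / 40) := by gcongr
    _ ≤ 0.04 := by norm_num

/-- A Harnack-type comparison: the log-likelihood ratio is at least `-0.15 - 1/3200 ≥ -0.151`, and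
`exp u ≥ 1 + u`. -/
theorem mul_targetDensity_le (h : IsRegular f θ₀ σ A) {y : ℝ} (hy : A * |y| ≤ 0.15 * σ ^ 2)
    {s t : ℝ} (hs : s ∈ Θ) (ht : t ∈ Θ) :
    0.849 * targetDensity f σ y s ≤ targetDensity f σ y t := by
  have hσ := h.pos
  have e : -(y - f t) ^ 2 / (2 * σ ^ 2) = -(y - f s) ^ 2 / (2 * σ ^ 2) +
      (2 * (y * (f t - f s)) + f s ^ 2 - f t ^ 2) / (2 * σ ^ 2) := by
    field_simp
    ring
  have h1 : -(0.15 * σ ^ 2) ≤ y * (f t - f s) := by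
    refine neg_le_of_abs_le ?_
    rw [abs_mul]
    refine le_trans ?_ hy
    rw [mul_comm]
    exact mul_le_mul_of_nonneg_right (h.abs_sub_le hs ht) (abs_nonneg y)
  have h2 := sq_le_sq' (neg_le_of_abs_le (h.abs_f_le t ht)) (le_of_abs_le (h.abs_f_le t ht))
  have h3 : -0.151 ≤ (2 * (y * (f t - f s)) + f s ^ 2 - f t ^ 2) / (2 * σ ^ 2) := by
    rw [le_div_iff₀ (by positivity)]
    nlinarith [sq_nonneg (f s)]
  have h4 : 0.849 ≤ Real.exp ((2 * (y * (f t - f s)) + f s ^ 2 - f t ^ 2) / (2 * σ ^ 2)) := by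
    refine le_trans ?_ (Real.add_one_le_exp _)
    linarith
  rw [targetDensity_eq, targetDensity_eq, e, Real.exp_add, mul_comm, ← mul_assoc]
  gcongr

theorem abs_gradTarget_le_targetDensity (h : IsRegular f θ₀ σ A) {y : ℝ}
    (hy : A * |y| ≤ 0.15 * σ ^ 2) {θ : ℝ} (hθ : θ ∈ Θ \ {θ₀}) :
    |gradTarget f σ y θ| ≤ 0.16 * targetDensity f σ y θ := by
  have hσ := h.pos
  rw [h.gradTarget_eq y hθ, mul_assoc, abs_mul, abs_of_nonneg (targetDensity_nonneg f σ y θ), mul_comm]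
  refine mul_le_mul_of_nonneg_right ?_ (targetDensity_nonneg f σ y θ)
  rw [abs_mul, abs_div, abs_of_pos (show 0 < σ ^ 2 by positivity), div_mul_eq_mul_div,
    div_le_iff₀ (by positivity)]
  have h1 : |y - f θ| ≤ |y| + σ / 40 := (abs_sub _ _).trans (by linarith [h.abs_f_le θ hθ.1])
  calc |y - f θ| * |derivWithin f Θ θ| ≤ (|y| + σ / 40) * A := by
        gcongr
        exact h.deriv_le θ hθ
    _ ≤ 0.16 * σ ^ 2 := by nlinarith [h.le, h.nonneg]

/-- A common form for all four branches. The strict inequalities in the case conditions keep the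
gradient away from `θ₀`; where no gradient occurs, `c = 0` and any other parameter serves. -/
theorem signedKernel_eq (h : IsRegular f θ₀ σ A) (x : ℝ) :
    ∃ c θ, |c| ≤ 1 ∧ θ ∈ Θ \ {θ₀} ∧
      ∀ y, signedKernel f θ₀ σ y x = gFun f θ₀ σ y + c * gradTarget f σ y θ := by
  obtain ⟨hl, hu⟩ := h.mem
  have h0 : ∃ θ, θ ∈ Θ \ {θ₀} := by
    rcases eq_or_ne θ₀ (1 / 2) with rfl | hne
    · exact ⟨-1 / 2, ⟨by norm_num, by norm_num⟩, by norm_num⟩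
    · exact ⟨1 / 2, ⟨by norm_num, by norm_num⟩, fun e => hne e.symm⟩
  obtain ⟨θ, hθ⟩ := h0
  unfold signedKernel
  split_ifs with h1 h2 h3
  · exact ⟨0, θ, by simp, hθ, by simp⟩
  · refine ⟨-1, x + 1 / 2, by simp, ⟨⟨by linarith, by linarith⟩, fun e => ?_⟩, fun y => by ring⟩
    rw [Set.mem_singleton_iff] at e
    linarith
  · refine ⟨1, x - 1 / 2, by simp, ⟨⟨by linarith, by linarith⟩, fun e => ?_⟩, fun y => by ring⟩
    rw [Set.mem_singleton_iff] at e
    linarith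
  · exact ⟨0, θ, by simp, hθ, by simp⟩

theorem half_mem : (1 / 2 : ℝ) ∈ Θ := ⟨by norm_num, by norm_num⟩

theorem neg_half_mem : (-1 / 2 : ℝ) ∈ Θ := ⟨by norm_num, by norm_num⟩

theorem signedKernel_le (h : IsRegular f θ₀ σ A) (y x : ℝ) :
    signedKernel f θ₀ σ y x ≤ 3 * baseDensity σ y 0 := by
  obtain ⟨c, θ, hc, hθ, e⟩ := h.signedKernel_eq x
  have h1 : |c * gradTarget f σ y θ| ≤ 0.04 * baseDensity σ y 0 := by
    rw [abs_mul]
    exact (mul_le_of_le_one_left (abs_nonneg _) hc).trans (h.abs_gradTarget_le y hθ)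
  rw [e, gFun]
  -- `2 · 1.42 + 0.04 ≤ 3`.
  linarith [le_of_abs_le h1, h.targetDensity_le y half_mem, h.targetDensity_le y neg_half_mem,
    targetDensity_nonneg f σ y θ₀, baseDensity_pos h.pos y 0]

theorem neg_signedKernel_le (h : IsRegular f θ₀ σ A) (y x : ℝ) :
    -signedKernel f θ₀ σ y x ≤ 1.5 * baseDensity σ y 0 := by
  obtain ⟨c, θ, hc, hθ, e⟩ := h.signedKernel_eq x
  have h1 : |c * gradTarget f σ y θ| ≤ 0.04 * baseDensity σ y 0 := by
    rw [abs_mul]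
    exact (mul_le_of_le_one_left (abs_nonneg _) hc).trans (h.abs_gradTarget_le y hθ)
  rw [e, gFun]
  linarith [neg_le_of_abs_le h1, h.targetDensity_le y h.mem, targetDensity_nonneg f σ y (1 / 2),
    targetDensity_nonneg f σ y (-1 / 2), baseDensity_pos h.pos y 0]

theorem abs_signedKernel_le (h : IsRegular f θ₀ σ A) (y x : ℝ) :
    |signedKernel f θ₀ σ y x| ≤ 3 * baseDensity σ y 0 :=
  abs_le.2 ⟨by linarith [h.neg_signedKernel_le y x, baseDensity_pos h.pos y 0],
    h.signedKernel_le y x⟩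

theorem signedKernel_nonneg (h : IsRegular f θ₀ σ A) {y : ℝ} (hy : A * |y| ≤ 0.15 * σ ^ 2)
    (x : ℝ) : 0 ≤ signedKernel f θ₀ σ y x := by
  obtain ⟨c, θ, hc, hθ, e⟩ := h.signedKernel_eq x
  have h1 : |c * gradTarget f σ y θ| ≤ 0.16 * targetDensity f σ y θ := by
    rw [abs_mul]
    exact (mul_le_of_le_one_left (abs_nonneg _) hc).trans (h.abs_gradTarget_le_targetDensity hy hθ)
  rw [e, gFun]
  -- In units of `v(y;θ)`: `2 · 0.849 - 1/0.849 - 0.16 > 0`.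
  linarith [neg_le_of_abs_le h1, h.mul_targetDensity_le hy hθ.1 half_mem,
    h.mul_targetDensity_le hy hθ.1 neg_half_mem, h.mul_targetDensity_le hy h.mem hθ.1,
    targetDensity_nonneg f σ y θ]

theorem integral_signedKernel (h : IsRegular f θ₀ σ A) (x : ℝ) :
    ∫ y, signedKernel f θ₀ σ y x = 1 := by
  obtain ⟨c, θ, -, hθ, e⟩ := h.signedKernel_eq x
  obtain ⟨hi, h0⟩ := integral_targetDensity_mul_sub f h.pos θ
  have e' : ∀ y, signedKernel f θ₀ σ y x = (targetDensity f σ y (1 / 2) +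
      targetDensity f σ y (-1 / 2) - targetDensity f σ y θ₀) +
        (c * derivWithin f Θ θ / σ ^ 2) * (targetDensity f σ y θ * (y - f θ)) := fun y => by
    rw [e, gFun, h.gradTarget_eq y hθ]
    ring
  have hI := integrable_targetDensity f σ
  have hI2 : Integrable fun y => targetDensity f σ y (1 / 2) + targetDensity f σ y (-1 / 2) :=
    (hI _).add (hI _)
  have hI3 : Integrable fun y => targetDensity f σ y (1 / 2) + targetDensity f σ y (-1 / 2) -
      targetDensity f σ y θ₀ := hI2.sub (hI _)
  simp_rw [e']
  rw [integral_add hI3 (hi.const_mul _), integral_sub hI2 (hI _),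
    integral_add (hI _) (hI _), integral_const_mul, h0]
  simp only [integral_targetDensity f h.pos]
  norm_num

end IsRegular

end RejectionKernel

namespace RejectionKernel

/-! ### Gaussian tails -/

/-- `exp(-σ² / (200 A²))`, with the value `0` at `A = 0`. -/
def realTail (σ A : ℝ) : ℝ := if A = 0 then 0 else Real.exp (-(σ ^ 2 / (200 * A ^ 2)))

theorem realTail_nonneg (σ A : ℝ) : 0 ≤ realTail σ A := by
  unfold realTail
  split_ifs
  · exact le_rfl
  · exact (Real.exp_pos _).le

/-- Gaussian tail bound for the base measure. -/
theorem gaussian_tail_le {σ A : ℝ} (hσ : 0 < σ) (hA : 0 ≤ A) :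
    (gaussianReal 0 (2 * σ ^ 2).toNNReal).real {y | 0.15 * σ ^ 2 < A * |y|} ≤
      2 * realTail σ A := by
  unfold realTail
  split_ifs with h0
  · have : {y : ℝ | 0.15 * σ ^ 2 < A * |y|} = ∅ := by
      ext y
      simp only [h0, zero_mul, Set.mem_ofPred_eq, Set.mem_empty_iff_false, iff_false, not_lt]
      positivity
    simp [this]
  · have hA' : 0 < A := lt_of_le_of_ne hA (Ne.symm h0)
    set R := 0.15 * σ ^ 2 / A with hR
    have hR0 : 0 < R := by positivity
    have hv : (((2 * σ ^ 2).toNNReal : ℝ≥0) : ℝ) = 2 * σ ^ 2 := Real.coe_toNNReal _ (by positivity)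
    -- Chernoff exponent at the optimal parameter `R/(2σ²)`: it equals `-R²/(4σ²) = -0.005625
    -- σ²/A²`, and `1/200 = 0.005`.
    have hexp : -(R / (2 * σ ^ 2)) * R + 2 * σ ^ 2 * (R / (2 * σ ^ 2)) ^ 2 / 2 ≤
        -(σ ^ 2 / (200 * A ^ 2)) := by
      have e : -(R / (2 * σ ^ 2)) * R + 2 * σ ^ 2 * (R / (2 * σ ^ 2)) ^ 2 / 2 =
          -(0.005625 * (σ ^ 2 / A ^ 2)) := by
        rw [hR]
        field_simp
        norm_num
      have e2 : σ ^ 2 / (200 * A ^ 2) = 0.005 * (σ ^ 2 / A ^ 2) := by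
        field_simp
        norm_num
      have : 0 ≤ σ ^ 2 / A ^ 2 := by positivity
      rw [e, e2]
      linarith
    have h1 := measure_ge_le_exp_mul_mgf (μ := gaussianReal 0 (2 * σ ^ 2).toNNReal) (X := id)
      (t := R / (2 * σ ^ 2)) R (by positivity) (integrable_exp_mul_gaussianReal _)
    have h2 := measure_le_le_exp_mul_mgf (μ := gaussianReal 0 (2 * σ ^ 2).toNNReal) (X := id)
      (t := -(R / (2 * σ ^ 2))) (-R) (neg_nonpos.2 (by positivity))
      (integrable_exp_mul_gaussianReal _)
    rw [mgf_id_gaussianReal, ← Real.exp_add, hv, zero_mul, zero_add] at h1 h2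
    rw [neg_sq, neg_neg, mul_neg, ← neg_mul] at h2
    have h3 := Real.exp_le_exp.2 hexp
    have hsub : {y : ℝ | 0.15 * σ ^ 2 < A * |y|} ⊆ {y | R ≤ id y} ∪ {y | id y ≤ -R} := by
      intro y hy
      have : R < |y| := by
        rw [hR, div_lt_iff₀ hA', mul_comm |y|]
        exact hy
      rcases lt_abs.1 this with h | h
      · exact Or.inl h.le
      · exact Or.inr (show y ≤ -R by linarith)
    refine (measureReal_mono hsub).trans ((measureReal_union_le _ _).trans ?_)
    linarith

/-! ### Measurability, exactness and negative mass of the signed kernel -/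

namespace IsRegular

variable {f : ℝ → ℝ} {θ₀ σ A : ℝ}

theorem measurable_signedKernel (h : IsRegular f θ₀ σ A) :
    Measurable fun z : ℝ × ℝ => signedKernel f θ₀ σ z.1 z.2 := by
  classical
  obtain ⟨hl, hu⟩ := h.mem
  have hf : Measurable (Θ.indicator f) := by
    rw [← Set.piecewise_eq_indicator]
    exact h.cont.measurable_piecewise continuousOn_const measurableSet_Icc
  have hf' := measurable_indicator_derivWithin f
  have hg : Measurable fun z : ℝ × ℝ => gFun f θ₀ σ z.1 :=
    (measurable_gFun f θ₀ σ).comp measurable_fst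
  -- Extending `f` and `f'` by zero outside `Θ` gives a jointly measurable function that agrees with
  -- the gradient wherever the kernel uses it.
  let G : ℝ × ℝ → ℝ := fun z => gaussianPDFReal (Θ.indicator f z.2) (σ ^ 2).toNNReal z.1 *
    ((z.1 - Θ.indicator f z.2) / σ ^ 2) * Θ.indicator (derivWithin f Θ) z.2
  have hG : Measurable G := by
    have h1 : Measurable fun z : ℝ × ℝ =>
        gaussianPDFReal (Θ.indicator f z.2) (σ ^ 2).toNNReal z.1 :=
      measurable_uncurry_gaussianPDFReal.comp
        ((hf.comp measurable_snd).prodMk (measurable_const.prodMk measurable_fst))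
    exact (h1.mul ((measurable_fst.sub (hf.comp measurable_snd)).div_const _)).mul
      (hf'.comp measurable_snd)
  have hGe (y : ℝ) {θ : ℝ} (hθ : θ ∈ Θ \ {θ₀}) : gradTarget f σ y θ = G (y, θ) := by
    rw [h.gradTarget_eq y hθ]
    simp only [G, Set.indicator_of_mem hθ.1, targetDensity]
  have he : (fun z : ℝ × ℝ => signedKernel f θ₀ σ z.1 z.2) = fun z =>
      if z.2 ≤ θ₀ - 1 / 2 then gFun f θ₀ σ z.1
      else if -1 / 2 + θ₀ < z.2 ∧ z.2 ≤ 0 then gFun f θ₀ σ z.1 - G (z.1, z.2 + 1 / 2)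
      else if 0 < z.2 ∧ z.2 < 1 / 2 + θ₀ then G (z.1, z.2 - 1 / 2) + gFun f θ₀ σ z.1
      else gFun f θ₀ σ z.1 := by
    funext z
    unfold signedKernel
    split_ifs with h1 h2 h3
    · rfl
    · rw [hGe]
      refine ⟨⟨by linarith, by linarith⟩, fun e => ?_⟩
      rw [Set.mem_singleton_iff] at e
      linarith
    · rw [hGe]
      refine ⟨⟨by linarith, by linarith⟩, fun e => ?_⟩
      rw [Set.mem_singleton_iff] at e
      linarith
    · rfl
  rw [he]
  refine Measurable.ite (measurableSet_le measurable_snd measurable_const) hg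
    (Measurable.ite ?_ (hg.sub (hG.comp (measurable_fst.prodMk (measurable_snd.add_const _))))
      (Measurable.ite ?_ ((hG.comp (measurable_fst.prodMk (measurable_snd.sub_const _))).add hg) hg))
  · exact (measurableSet_lt measurable_const measurable_snd).inter
      (measurableSet_le measurable_snd measurable_const)
  · exact (measurableSet_lt measurable_const measurable_snd).inter
      (measurableSet_lt measurable_snd measurable_const)

theorem measurable_signedKernel_left (h : IsRegular f θ₀ σ A) (x : ℝ) :
    Measurable fun y => signedKernel f θ₀ σ y x :=
  h.measurable_signedKernel.comp (measurable_id.prodMk measurable_const)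

theorem integrable_signedKernel (h : IsRegular f θ₀ σ A) (x : ℝ) :
    Integrable fun y => signedKernel f θ₀ σ y x :=
  ((integrable_baseDensity σ 0).const_mul 3).mono' (h.measurable_signedKernel_left x).aestronglyMeasurable
    (Filter.Eventually.of_forall fun y => h.abs_signedKernel_le y x)

theorem continuousOn_targetDensity (h : IsRegular f θ₀ σ A) (y : ℝ) :
    ContinuousOn (fun θ => targetDensity f σ y θ) Θ := by
  simp_rw [targetDensity_eq]
  have := h.cont
  fun_prop

theorem integral_gradTarget (h : IsRegular f θ₀ σ A) (y : ℝ) {a b : ℝ} (ha : a ∈ Θ) (hb : b ∈ Θ) :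
    ∫ θ in a..b, gradTarget f σ y θ = targetDensity f σ y b - targetDensity f σ y a :=
  integral_derivWithin_Θ (h.continuousOn_targetDensity y)
    (fun t ht => (hasDerivWithinAt_targetDensity h.pos y
      (h.diff t ht).hasDerivWithinAt).differentiableWithinAt)
    (fun _ ht => h.abs_gradTarget_le y ht) ha hb

/-- The signed kernel maps the source experiment exactly to the target experiment. -/
theorem integral_signedKernel_source (h : IsRegular f θ₀ σ A) (y : ℝ) {θ : ℝ} (hθ : θ ∈ Θ) :
    ∫ x, signedKernel f θ₀ σ y x ∂uniformSource θ = targetDensity f σ y θ := by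
  obtain ⟨hl, hu⟩ := h.mem
  obtain ⟨hl', hu'⟩ := hθ
  set D : ℝ → ℝ := fun x => signedKernel f θ₀ σ y x - gFun f θ₀ σ y with hD
  have hSm : Measurable fun x => signedKernel f θ₀ σ y x :=
    h.measurable_signedKernel.comp (measurable_const.prodMk measurable_id)
  have hint (a b : ℝ) : IntervalIntegrable (fun x => signedKernel f θ₀ σ y x) volume a b := by
    rw [intervalIntegrable_iff]
    exact Integrable.mono' (integrableOn_const (C := 3 * baseDensity σ y 0) (by simp [Set.uIoc]))
      hSm.aestronglyMeasurable (Filter.Eventually.of_forall fun x => h.abs_signedKernel_le y x)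
  have hDint (a b : ℝ) : IntervalIntegrable D volume a b :=
    (hint a b).sub intervalIntegrable_const
  have hmax : max θ θ₀ ∈ Θ := by
    rcases max_choice θ θ₀ with e | e <;> rw [e]
    exacts [⟨hl', hu'⟩, ⟨hl, hu⟩]
  have hmin : min θ θ₀ ∈ Θ := by
    rcases min_choice θ θ₀ with e | e <;> rw [e]
    exacts [⟨hl', hu'⟩, ⟨hl, hu⟩]
  -- Degenerate unless `θ < θ₀`; in that case the whole interval lies in the first branch.
  have h1 : ∫ x in (θ - 1 / 2)..(max θ θ₀ - 1 / 2), D x = 0 := by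
    refine intervalIntegral.integral_zero_ae (Filter.Eventually.of_forall fun x hx => ?_)
    rw [Set.uIoc_of_le (by linarith [le_max_left θ θ₀])] at hx
    have : max θ θ₀ = θ₀ := by
      refine (max_choice θ θ₀).resolve_left fun e => ?_
      rw [e] at hx
      exact absurd hx.1 (not_lt.2 hx.2)
    rw [this] at hx
    simp only [hD, signedKernel]
    rw [if_pos hx.2, sub_self]
  have h2 : ∫ x in (max θ θ₀ - 1 / 2)..0, D x =
      targetDensity f σ y (max θ θ₀) - targetDensity f σ y (1 / 2) := by
    have e : ∫ x in (max θ θ₀ - 1 / 2)..0, D x =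
        ∫ x in (max θ θ₀ - 1 / 2)..0, -gradTarget f σ y (x + 1 / 2) := by
      refine intervalIntegral.integral_congr_ae (Filter.Eventually.of_forall fun x hx => ?_)
      rw [Set.uIoc_of_le (by linarith [hmax.2])] at hx
      have := hx.1
      have := le_max_right θ θ₀
      simp only [hD, signedKernel]
      rw [if_neg (by linarith), if_pos ⟨by linarith, hx.2⟩]
      ring
    rw [e, intervalIntegral.integral_neg,
      intervalIntegral.integral_comp_add_right (fun x => gradTarget f σ y x), sub_add_cancel,
      zero_add, h.integral_gradTarget y hmax half_mem, neg_sub]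
  have h3 : ∫ x in (0)..(min θ θ₀ + 1 / 2), D x =
      targetDensity f σ y (min θ θ₀) - targetDensity f σ y (-1 / 2) := by
    have e : ∫ x in (0)..(min θ θ₀ + 1 / 2), D x =
        ∫ x in (0)..(min θ θ₀ + 1 / 2), gradTarget f σ y (x - 1 / 2) := by
      refine intervalIntegral.integral_congr_ae ?_
      -- The end point `θ₀ + 1/2` falls into the last branch and is discarded as a null set.
      filter_upwards [measure_eq_zero_iff_ae_notMem.1 (Real.volume_singleton (a := θ₀ + 1 / 2))]
        with x hne hx
      rw [Set.uIoc_of_le (by linarith [hmin.1])] at hx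
      have h4 : x ≤ θ₀ + 1 / 2 := hx.2.trans (by linarith [min_le_right θ θ₀])
      have h5 : x < θ₀ + 1 / 2 := lt_of_le_of_ne h4 hne
      have := hx.1
      simp only [hD, signedKernel]
      rw [if_neg (by linarith), if_neg (by intro h; linarith [h.2]), if_pos ⟨hx.1, by linarith⟩]
      ring
    rw [e, intervalIntegral.integral_comp_sub_right (fun x => gradTarget f σ y x), add_sub_cancel_right,
      zero_sub, ← neg_div, h.integral_gradTarget y neg_half_mem hmin]
  have h4 : ∫ x in (min θ θ₀ + 1 / 2)..(θ + 1 / 2), D x = 0 := by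
    refine intervalIntegral.integral_zero_ae (Filter.Eventually.of_forall fun x hx => ?_)
    rw [Set.uIoc_of_le (by linarith [min_le_left θ θ₀])] at hx
    have : min θ θ₀ = θ₀ := by
      refine (min_choice θ θ₀).resolve_left fun e => ?_
      rw [e] at hx
      exact absurd hx.1 (not_lt.2 hx.2)
    rw [this] at hx
    have := hx.1
    simp only [hD, signedKernel]
    rw [if_neg (by linarith), if_neg (by intro h; linarith [h.2]), if_neg (by intro h; linarith [h.2]),
      sub_self]
  have h5 : ∫ x in (θ - 1 / 2)..(θ + 1 / 2), D x =
      targetDensity f σ y (max θ θ₀) - targetDensity f σ y (1 / 2) +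
        (targetDensity f σ y (min θ θ₀) - targetDensity f σ y (-1 / 2)) := by
    rw [← intervalIntegral.integral_add_adjacent_intervals (hDint (θ - 1 / 2) 0) (hDint _ _),
      ← intervalIntegral.integral_add_adjacent_intervals (hDint (θ - 1 / 2) (max θ θ₀ - 1 / 2))
        (hDint _ 0),
      ← intervalIntegral.integral_add_adjacent_intervals (hDint 0 (min θ θ₀ + 1 / 2)) (hDint _ _),
      h1, h2, h3, h4, zero_add, add_zero]
  have h6 : targetDensity f σ y (max θ θ₀) + targetDensity f σ y (min θ θ₀) =
      targetDensity f σ y θ + targetDensity f σ y θ₀ := by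
    rcases le_total θ θ₀ with e | e
    · rw [max_eq_right e, min_eq_left e, add_comm]
    · rw [max_eq_left e, min_eq_right e]
  rw [hD, intervalIntegral.integral_sub (hint _ _) intervalIntegrable_const,
    intervalIntegral.integral_const, intervalIntegral.integral_of_le (by linarith),
    ← integral_Icc_eq_integral_Ioc] at h5
  rw [uniformSource]
  simp only [gFun, smul_eq_mul] at h5
  linarith

theorem integrable_negPart (h : IsRegular f θ₀ σ A) (x : ℝ) :
    Integrable fun y => max (-signedKernel f θ₀ σ y x) 0 := (h.integrable_signedKernel x).neg_part

/-- The negative part lives on the tail event and is at most `1.5` times the base density there; the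
two-sided tail bound supplies the other factor `2`. -/
theorem integral_negPart_le (h : IsRegular f θ₀ σ A) (x : ℝ) :
    ∫ y, max (-signedKernel f θ₀ σ y x) 0 ≤ 3 * realTail σ A := by
  set B : Set ℝ := {y | 0.15 * σ ^ 2 < A * |y|}
  have hB : MeasurableSet B :=
    measurableSet_lt measurable_const (measurable_const.mul measurable_id.abs)
  have hv := two_mul_sq_toNNReal_ne_zero h.pos
  have h1 : ∫ y, max (-signedKernel f θ₀ σ y x) 0 ≤
      ∫ y, B.indicator (fun y => 1.5 * baseDensity σ y 0) y := by
    refine integral_mono (h.integrable_negPart x)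
      (((integrable_baseDensity σ 0).const_mul _).indicator hB) fun y => ?_
    by_cases hy : y ∈ B
    · simp only [Set.indicator_of_mem hy]
      exact max_le (h.neg_signedKernel_le y x) (by have := baseDensity_pos h.pos y 0; positivity)
    · simp only [Set.indicator_of_notMem hy]
      exact max_le (neg_nonpos.2 (h.signedKernel_nonneg (not_lt.1 hy) x)) le_rfl
  have h2 : ∫ y in B, baseDensity σ y 0 = (gaussianReal 0 (2 * σ ^ 2).toNNReal).real B := by
    rw [Measure.real, gaussianReal_apply_eq_integral _ hv,
      ENNReal.toReal_ofReal (integral_nonneg fun y => gaussianPDFReal_nonneg _ _ _)]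
    rfl
  rw [integral_indicator hB, integral_const_mul, h2] at h1
  have h3 : (gaussianReal 0 (2 * σ ^ 2).toNNReal).real B ≤ 2 * realTail σ A :=
    gaussian_tail_le h.pos h.nonneg
  linarith

/-! ### The law of the algorithm with the signed kernel -/

theorem measurableSet_acceptSet_prod (h : IsRegular f θ₀ σ A) (M : ℝ) :
    MeasurableSet {z : ℝ × ℝ × ℝ |
      z.2 ∈ acceptSet (signedKernel f θ₀ σ) (baseDensity σ) M z.1} := by
  have hS : Measurable fun z : ℝ × ℝ × ℝ => signedKernel f θ₀ σ z.2.2 z.1 :=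
    h.measurable_signedKernel.comp (measurable_snd.snd.prodMk measurable_fst)
  have hp : Measurable fun z : ℝ × ℝ × ℝ => baseDensity σ z.2.2 z.1 :=
    (measurable_gaussianPDFReal 0 (2 * σ ^ 2).toNNReal).comp measurable_snd.snd
  exact measurableSet_le measurable_snd.fst
    (((hS.max measurable_const).div hp).const_mul _)

theorem measurableSet_acceptSet (h : IsRegular f θ₀ σ A) (M x : ℝ) :
    MeasurableSet (acceptSet (signedKernel f θ₀ σ) (baseDensity σ) M x) :=
  (h.measurableSet_acceptSet_prod M).preimage measurable_prodMk_left

end IsRegular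

/-- The law of a pair of draws `(U_t, Y_t)`. -/
def drawLaw (σ : ℝ) : Measure (ℝ × ℝ) :=
  ((volume : Measure ℝ).restrict (Set.Icc 0 1)).prod
    ((volume : Measure ℝ).withDensity fun y => ENNReal.ofReal (baseDensity σ y 0))

theorem isProbabilityMeasure_drawLaw {σ : ℝ} (hσ : 0 < σ) : IsProbabilityMeasure (drawLaw σ) := by
  have h1 : (volume : Measure ℝ).withDensity (fun y => ENNReal.ofReal (baseDensity σ y 0)) =
      gaussianReal 0 (2 * σ ^ 2).toNNReal :=
    (gaussianReal_of_var_ne_zero _ (two_mul_sq_toNNReal_ne_zero hσ)).symm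
  have h2 : IsProbabilityMeasure ((volume : Measure ℝ).restrict (Set.Icc 0 1)) := ⟨by simp⟩
  rw [drawLaw, h1]
  infer_instance

namespace IsRegular

variable {f : ℝ → ℝ} {θ₀ σ A : ℝ}

theorem rkLaw_eq (h : IsRegular f θ₀ σ A) (N M y₀ x : ℝ) {C : Set ℝ} (hC : MeasurableSet C) :
    rkLaw (signedKernel f θ₀ σ) (baseDensity σ) N M y₀ x C =
      ∑ k ∈ Finset.range ⌈N + 1⌉₊,
          drawLaw σ (acceptSet (signedKernel f θ₀ σ) (baseDensity σ) M x)ᶜ ^ k *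
          drawLaw σ (acceptSet (signedKernel f θ₀ σ) (baseDensity σ) M x ∩ Prod.snd ⁻¹' C) +
        drawLaw σ (acceptSet (signedKernel f θ₀ σ) (baseDensity σ) M x)ᶜ ^ ⌈N + 1⌉₊ *
          Set.indicator C 1 y₀ := by
  have := isProbabilityMeasure_drawLaw h.pos
  exact rkLaw_apply (ν := drawLaw σ) N y₀ (h.measurableSet_acceptSet M x) rfl hC

theorem isProbabilityMeasure_rkLaw (h : IsRegular f θ₀ σ A) (N M y₀ x : ℝ) :
    IsProbabilityMeasure (rkLaw (signedKernel f θ₀ σ) (baseDensity σ) N M y₀ x) := by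
  have := isProbabilityMeasure_drawLaw h.pos
  have : IsProbabilityMeasure (tapeLaw (baseDensity σ) x) :=
    inferInstanceAs (IsProbabilityMeasure (Measure.infinitePi fun _ : ℕ => drawLaw σ))
  exact Measure.isProbabilityMeasure_map
    (measurable_rkOutput N y₀ (h.measurableSet_acceptSet M x)).aemeasurable

/-- The closed form `rkLaw_eq` depends on `x` only through measures of sections of jointly
measurable sets. -/
theorem measurable_rkLaw (h : IsRegular f θ₀ σ A) (N M y₀ : ℝ) :
    Measurable (rkLaw (signedKernel f θ₀ σ) (baseDensity σ) N M y₀) := by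
  have := isProbabilityMeasure_drawLaw h.pos
  refine Measure.measurable_of_measurable_coe _ fun C hC => ?_
  simp_rw [h.rkLaw_eq N M y₀ _ hC]
  have h1 : Measurable fun x =>
      drawLaw σ (acceptSet (signedKernel f θ₀ σ) (baseDensity σ) M x)ᶜ :=
    measurable_measure_prodMk_left (h.measurableSet_acceptSet_prod M).compl
  have h2 : Measurable fun x =>
      drawLaw σ (acceptSet (signedKernel f θ₀ σ) (baseDensity σ) M x ∩ Prod.snd ⁻¹' C) :=
    measurable_measure_prodMk_left
      ((h.measurableSet_acceptSet_prod M).inter (measurable_snd.snd hC))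
  exact (Finset.measurable_sum _ fun k _ => (h1.pow_const k).mul h2).add
    ((h1.pow_const _).mul_const _)

/-- The algorithm as a Markov kernel. -/
def rkKernel (h : IsRegular f θ₀ σ A) (N M y₀ : ℝ) : Kernel ℝ ℝ where
  toFun := rkLaw (signedKernel f θ₀ σ) (baseDensity σ) N M y₀
  measurable' := h.measurable_rkLaw N M y₀

theorem isMarkovKernel_rkKernel (h : IsRegular f θ₀ σ A) (N M y₀ : ℝ) :
    IsMarkovKernel (h.rkKernel N M y₀) :=
  ⟨fun x => h.isProbabilityMeasure_rkLaw N M y₀ x⟩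

theorem integrable_posPart (h : IsRegular f θ₀ σ A) (x : ℝ) :
    Integrable fun y => max (signedKernel f θ₀ σ y x) 0 := (h.integrable_signedKernel x).pos_part

theorem drawLaw_real_accept (h : IsRegular f θ₀ σ A) {M : ℝ} (hM : 3 ≤ M) (x : ℝ) {C : Set ℝ}
    (hC : MeasurableSet C) :
    (drawLaw σ).real (acceptSet (signedKernel f θ₀ σ) (baseDensity σ) M x ∩ Prod.snd ⁻¹' C) =
      (∫ y in C, max (signedKernel f θ₀ σ y x) 0) / M := by
  have hM0 : 0 < M := by linarith
  have hle (y : ℝ) : max (signedKernel f θ₀ σ y x) 0 ≤ M * baseDensity σ y x := by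
    have hp : 0 < baseDensity σ y 0 := baseDensity_pos h.pos y 0
    refine max_le ((h.signedKernel_le y x).trans ?_) (mul_pos hM0 hp).le
    exact mul_le_mul_of_nonneg_right hM hp.le
  have h1 := prod_acceptSet hM0 (h.measurable_signedKernel_left x)
    (show Measurable fun y => baseDensity σ y x from measurable_gaussianPDFReal _ _)
    (fun y => baseDensity_pos h.pos y x) hle (h.measurableSet_acceptSet M x) hC
  rw [Measure.real, show drawLaw σ = _ from rfl]
  refine (congrArg ENNReal.toReal h1).trans ?_
  rw [← ofReal_integral_eq_lintegral_ofReal ((h.integrable_posPart x).integrableOn.div_const M)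
      (Filter.Eventually.of_forall fun y => div_nonneg (le_max_right _ _) hM0.le),
    integral_div, ENNReal.toReal_ofReal]
  exact div_nonneg (integral_nonneg fun y => le_max_right _ _) hM0.le

/-- Pointwise comparison of the law of the algorithm with the signed kernel. -/
theorem abs_rkLaw_sub_le (h : IsRegular f θ₀ σ A) (N y₀ x : ℝ) {C : Set ℝ}
    (hC : MeasurableSet C) :
    |(rkLaw (signedKernel f θ₀ σ) (baseDensity σ) N 30 y₀ x).real C -
        ∫ y in C, signedKernel f θ₀ σ y x| ≤
      Real.exp (-(N / 30)) + 3 * realTail σ A := by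
  have := isProbabilityMeasure_drawLaw h.pos
  set E := acceptSet (signedKernel f θ₀ σ) (baseDensity σ) 30 x with hE
  have hEm : MeasurableSet E := h.measurableSet_acceptSet 30 x
  set n := ⌈N + 1⌉₊ with hn
  set r := (drawLaw σ).real Eᶜ with hr
  set Q := ∫ y in C, max (signedKernel f θ₀ σ y x) 0 with hQ
  set s := ∫ y, max (signedKernel f θ₀ σ y x) 0 with hs
  set m := ∫ y, max (-signedKernel f θ₀ σ y x) 0 with hm
  set mC := ∫ y in C, max (-signedKernel f θ₀ σ y x) 0 with hmC
  have hposi := h.integrable_posPart x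
  have hnegi := h.integrable_negPart x
  have hdec (y : ℝ) : signedKernel f θ₀ σ y x =
      max (signedKernel f θ₀ σ y x) 0 - max (-signedKernel f θ₀ σ y x) 0 := by
    rcases le_total 0 (signedKernel f θ₀ σ y x) with h | h
    · rw [max_eq_left h, max_eq_right (by linarith), sub_zero]
    · rw [max_eq_right h, max_eq_left (by linarith)]
      ring
  -- Unit total mass gives `s = 1 + m ≥ 1`, hence acceptance probability `s / 30 ≥ 1/30`.
  have hsm : s - m = 1 := by
    rw [hs, hm, ← integral_sub hposi hnegi, ← h.integral_signedKernel x]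
    exact integral_congr_ae (Filter.Eventually.of_forall fun y => (hdec y).symm)
  have hSC : ∫ y in C, signedKernel f θ₀ σ y x = Q - mC := by
    rw [hQ, hmC, ← integral_sub hposi.integrableOn hnegi.integrableOn]
    exact integral_congr_ae (Filter.Eventually.of_forall hdec)
  have hQ0 : 0 ≤ Q := integral_nonneg fun y => le_max_right _ _
  have hQs : Q ≤ s :=
    setIntegral_le_integral hposi (Filter.Eventually.of_forall fun y => le_max_right _ _)
  have hmC0 : 0 ≤ mC := integral_nonneg fun y => le_max_right _ _
  have hmCm : mC ≤ m :=
    setIntegral_le_integral hnegi (Filter.Eventually.of_forall fun y => le_max_right _ _)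
  have hs1 : 1 ≤ s := by linarith
  have hr0 : 0 ≤ r := measureReal_nonneg
  have hrs : r = 1 - s / 30 := by
    have h1 := h.drawLaw_real_accept (M := 30) (by norm_num) x MeasurableSet.univ
    rw [Set.preimage_univ, Set.inter_univ, setIntegral_univ] at h1
    rw [hr, probReal_compl_eq_one_sub hEm, h1]
  have hgeom : (∑ k ∈ Finset.range n, r ^ k) * (s / 30) = 1 - r ^ n := by
    rw [← geom_sum_mul_neg, hrs]
    ring
  have hrn : r ^ n ≤ Real.exp (-(N / 30)) := by
    have h1 : r ≤ Real.exp (-(1 / 30)) := by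
      have := Real.one_sub_le_exp_neg (1 / 30)
      linarith
    calc r ^ n ≤ Real.exp (-(1 / 30)) ^ n := by gcongr
      _ = Real.exp (-(n / 30)) := by
        rw [← Real.exp_nat_mul]
        ring_nf
      _ ≤ _ := by
        have := Nat.le_ceil (N + 1)
        rw [← hn] at this
        exact Real.exp_le_exp.2 (by linarith)
  obtain ⟨δ, hδ0, hδ1, hL⟩ : ∃ δ : ℝ, 0 ≤ δ ∧ δ ≤ 1 ∧
      (rkLaw (signedKernel f θ₀ σ) (baseDensity σ) N 30 y₀ x).real C =
        (∑ k ∈ Finset.range n, r ^ k) * (Q / 30) + r ^ n * δ := by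
    refine ⟨C.indicator 1 y₀, Set.indicator_nonneg (fun _ _ => zero_le_one) _,
      Set.indicator_le_self' (fun _ _ => zero_le_one) _, ?_⟩
    rw [Measure.real, h.rkLaw_eq N 30 y₀ x hC, ← hE, ← hn, ENNReal.toReal_add, ENNReal.toReal_sum,
      Finset.sum_mul, ← h.drawLaw_real_accept (by norm_num) x hC]
    · congr 1
      · simp [hr, Measure.real, ← hE]
      · by_cases hy : y₀ ∈ C <;> simp [hy, hr, Measure.real]
    · exact fun k _ => ENNReal.mul_ne_top (ENNReal.pow_ne_top (measure_ne_top _ _))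
        (measure_ne_top _ _)
    · exact ENNReal.sum_ne_top.2 fun k _ => ENNReal.mul_ne_top
        (ENNReal.pow_ne_top (measure_ne_top _ _)) (measure_ne_top _ _)
    · refine ENNReal.mul_ne_top (ENNReal.pow_ne_top (measure_ne_top _ _)) ?_
      by_cases hy : y₀ ∈ C <;> simp [hy]
  set w := Q / s with hw
  have hw0 : 0 ≤ w := by positivity
  have hw1 : w ≤ 1 := (div_le_one (by linarith)).2 hQs
  have hQw : Q = w * s := by
    rw [hw]
    field_simp
  have hL' : (∑ k ∈ Finset.range n, r ^ k) * (Q / 30) = w * (1 - r ^ n) := by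
    rw [← hgeom, hQw]
    ring
  -- `w` is the probability of `C` for an accepted draw. The first term is the failure of all `n`
  -- rounds, with `|δ - w| ≤ 1`; in the second, `mC` and `w * m` both lie in `[0, m]`.
  have hfin : w * (1 - r ^ n) + r ^ n * δ - (Q - mC) = r ^ n * (δ - w) + (mC - w * m) := by
    rw [hQw, show s = 1 + m by linarith]
    ring
  rw [hL, hL', hSC, hfin]
  refine (abs_add_le _ _).trans (add_le_add ?_ ?_)
  · rw [abs_mul, abs_of_nonneg (pow_nonneg hr0 n)]
    refine le_trans (mul_le_of_le_one_right (pow_nonneg hr0 n) ?_) hrn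
    rw [abs_le]
    constructor <;> linarith
  · refine le_trans ?_ (h.integral_negPart_le x)
    have hm0 : 0 ≤ m := hmC0.trans hmCm
    have := mul_nonneg hw0 hm0
    have := mul_le_of_le_one_left hm0 hw1
    rw [abs_le]
    constructor <;> linarith

end IsRegular

end RejectionKernel

namespace RejectionKernel

/-! ### Total variation and deficiency bounds -/

theorem tvDist_comm {Y : Type*} [MeasurableSpace Y] (μ ν : Measure Y) :
    tvDist μ ν = tvDist ν μ := by
  simp only [tvDist, abs_sub_comm]

theorem isProbabilityMeasure_uniformSource (θ : ℝ) : IsProbabilityMeasure (uniformSource θ) :=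
  ⟨by simp [uniformSource]; norm_num⟩

namespace IsRegular

variable {f : ℝ → ℝ} {θ₀ σ A : ℝ}

/-- By Fubini and exactness, the target probability of `C` is the source average of `∫_C S*(y|x)
dy`, so the error for fixed `x` is merely averaged. -/
theorem abs_bind_rkKernel_sub_le (h : IsRegular f θ₀ σ A) (N y₀ : ℝ) {θ : ℝ} (hθ : θ ∈ Θ)
    {C : Set ℝ} (hC : MeasurableSet C) :
    |((uniformSource θ).bind (h.rkKernel N 30 y₀)).real C - (gaussianTarget f σ θ).real C| ≤
      Real.exp (-(N / 30)) + 3 * realTail σ A := by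
  have := isProbabilityMeasure_uniformSource θ
  have := h.isMarkovKernel_rkKernel N 30 y₀
  set T := h.rkKernel N 30 y₀ with hT
  have hTm : Measurable fun x => T x C := T.measurable_coe hC
  have h1 : ((uniformSource θ).bind T).real C = ∫ x, (T x).real C ∂uniformSource θ := by
    rw [Measure.real, Measure.bind_apply hC T.measurable.aemeasurable]
    exact (integral_toReal hTm.aemeasurable
      (Filter.Eventually.of_forall fun x => measure_lt_top _ _)).symm
  have hprod : Integrable (fun z : ℝ × ℝ => signedKernel f θ₀ σ z.2 z.1)
      ((uniformSource θ).prod (volume.restrict C)) := by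
    refine Integrable.mono' (g := fun z : ℝ × ℝ => 3 * baseDensity σ z.2 0) ?_
      (h.measurable_signedKernel.comp measurable_swap).aestronglyMeasurable
      (Filter.Eventually.of_forall fun z => h.abs_signedKernel_le z.2 z.1)
    exact Integrable.comp_snd ((integrable_baseDensity σ 0).integrableOn.const_mul 3) _
  have h2 : (gaussianTarget f σ θ).real C =
      ∫ x, (∫ y in C, signedKernel f θ₀ σ y x) ∂uniformSource θ := by
    rw [integral_integral_swap hprod]
    simp_rw [h.integral_signedKernel_source _ hθ]
    rw [gaussianTarget, Measure.real, gaussianReal_apply_eq_integral _ (sq_toNNReal_ne_zero h.pos),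
      ENNReal.toReal_ofReal (integral_nonneg fun y => gaussianPDFReal_nonneg _ _ _)]
    rfl
  have h3 : Integrable (fun x => (T x).real C) (uniformSource θ) :=
    Integrable.mono' (integrable_const 1) hTm.ennreal_toReal.aestronglyMeasurable
      (Filter.Eventually.of_forall fun x => by
        rw [Real.norm_of_nonneg measureReal_nonneg]
        exact measureReal_le_one)
  rw [h1, h2, ← integral_sub h3 hprod.integral_prod_left, ← Real.norm_eq_abs]
  refine (norm_integral_le_of_norm_le_const
    (Filter.Eventually.of_forall fun x => h.abs_rkLaw_sub_le N y₀ x hC)).trans ?_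
  simp

theorem tvDist_bind_rkKernel_le (h : IsRegular f θ₀ σ A) {ε : ℝ} (hε : 0 < ε) (hε1 : ε < 1)
    (y₀ : ℝ) {θ : ℝ} (hθ : θ ∈ Θ) :
    tvDist ((uniformSource θ).bind (h.rkKernel (60 * Real.log (4 / ε)) 30 y₀))
        (gaussianTarget f σ θ) ≤
      ENNReal.ofReal (ε / 2 + 10 * realTail σ A) := by
  refine iSup₂_le fun C hC => ENNReal.ofReal_le_ofReal ?_
  refine (h.abs_bind_rkKernel_sub_le _ y₀ hθ hC).trans ?_
  -- The left side is `(ε/4)²`.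
  have h1 : Real.exp (-(60 * Real.log (4 / ε) / 30)) ≤ ε / 2 := by
    have e : -(60 * Real.log (4 / ε) / 30) = Real.log (ε / 4) + Real.log (ε / 4) := by
      rw [← inv_div ε 4, Real.log_inv]
      ring
    rw [e, Real.exp_add, Real.exp_log (by positivity)]
    nlinarith
  have := realTail_nonneg σ A
  linarith

end IsRegular

/-! ### From real bounds to extended-real suprema -/

theorem ten_mul_realTail_le {σ A ε : ℝ} (hA : 0 ≤ A) (hε : 0 < ε) (hε1 : ε < 1)
    (h : 10 * A * √(2 * Real.log (20 / ε)) ≤ σ) : 10 * realTail σ A ≤ ε / 2 := by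
  unfold realTail
  split_ifs with h0
  · linarith
  · have hA' : 0 < A := lt_of_le_of_ne hA (Ne.symm h0)
    have hlog : 0 ≤ Real.log (20 / ε) := Real.log_nonneg (by rw [le_div_iff₀ hε]; linarith)
    have h1 : Real.log (20 / ε) ≤ σ ^ 2 / (200 * A ^ 2) := by
      rw [le_div_iff₀ (by positivity)]
      have h2 := pow_le_pow_left₀ (by positivity) h 2
      rw [mul_pow, Real.sq_sqrt (by positivity)] at h2
      linarith
    have h3 : Real.exp (-(σ ^ 2 / (200 * A ^ 2))) ≤ ε / 20 := by
      rw [← Real.exp_log (show 0 < ε / 20 by positivity), ← inv_div 20 ε, Real.log_inv]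
      exact Real.exp_le_exp.2 (neg_le_neg h1)
    linarith

theorem expTail_ofReal {σ A : ℝ} (hσ : 0 < σ) (hA : 0 ≤ A) :
    expTail σ (ENNReal.ofReal A) = ENNReal.ofReal (realTail σ A) := by
  unfold expTail realTail
  split_ifs with h0
  · have h1 : ENNReal.ofReal σ ^ 2 / (200 * ENNReal.ofReal A ^ 2) = ⊤ := by
      rw [h0]
      simp [ENNReal.div_zero, hσ]
    rw [h1]
    simp
  · have hA' : 0 < A := lt_of_le_of_ne hA (Ne.symm h0)
    have h1 : ENNReal.ofReal σ ^ 2 / (200 * ENNReal.ofReal A ^ 2) =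
        ENNReal.ofReal (σ ^ 2 / (200 * A ^ 2)) := by
      rw [ENNReal.ofReal_div_of_pos (by positivity), ENNReal.ofReal_mul (by norm_num),
        ENNReal.ofReal_pow hσ.le, ENNReal.ofReal_pow hA, ENNReal.ofReal_ofNat]
    rw [h1, EReal.coe_ennreal_ofReal, max_eq_left (by positivity), ← EReal.coe_neg, EReal.exp_coe]

/-- The lower bound on the finite `σ` forces `α₁ < ∞`, so passing to `toReal` loses nothing. -/
theorem isRegular_of_alpha_le {f : ℝ → ℝ} {θ₀ σ : ℝ} (hθ₀ : θ₀ ∈ Θ) (hc : ContinuousOn f Θ)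
    (hd : ∀ t ∈ Θ \ {θ₀}, DifferentiableWithinAt ℝ f Θ t) (hσ : 0 < σ)
    (h : 40 * max (alpha0 f) (alpha1 f θ₀) ≤ ENNReal.ofReal σ) :
    IsRegular f θ₀ σ (alpha1 f θ₀).toReal ∧ alpha1 f θ₀ ≠ ⊤ := by
  have hmax : max (alpha0 f) (alpha1 f θ₀) ≤ ENNReal.ofReal (σ / 40) := by
    rw [ENNReal.ofReal_div_of_pos (by norm_num), ENNReal.ofReal_ofNat,
      ENNReal.le_div_iff_mul_le (by simp) (by simp), mul_comm]
    exact h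
  have h0 : alpha0 f ≤ ENNReal.ofReal (σ / 40) := (le_max_left _ _).trans hmax
  have h1 : alpha1 f θ₀ ≤ ENNReal.ofReal (σ / 40) := (le_max_right _ _).trans hmax
  have hne : alpha1 f θ₀ ≠ ⊤ := ne_top_of_le_ne_top ENNReal.ofReal_ne_top h1
  refine ⟨⟨hθ₀, hc, hd, hσ, fun t ht => ?_, fun t ht => ?_, ENNReal.toReal_nonneg, ?_⟩, hne⟩
  · rw [← ENNReal.ofReal_le_ofReal_iff (by positivity)]
    exact (le_iSup₂ (f := fun t (_ : t ∈ Θ) => ENNReal.ofReal |f t|) t ht).trans h0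
  · rw [← ENNReal.ofReal_le_iff_le_toReal hne]
    exact le_iSup₂ (f := fun t (_ : t ∈ Θ \ {θ₀}) => ENNReal.ofReal |derivWithin f Θ t|) t ht
  · exact ENNReal.toReal_le_of_le_ofReal (by positivity) h1

end RejectionKernel

end

theorem theorem3 :
    -- the constant of the running time is universal
    ∃ K : ℝ, 0 < K ∧
      ∀ (f : ℝ → ℝ) (θ₀ : ℝ), θ₀ ∈ RejectionKernel.Θ →
      ContinuousOn f RejectionKernel.Θ →
      (∀ t ∈ RejectionKernel.Θ \ {θ₀}, DifferentiableWithinAt ℝ f RejectionKernel.Θ t) →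
      ∀ σ : ℝ, 0 < σ →
      40 * max (RejectionKernel.alpha0 f) (RejectionKernel.alpha1 f θ₀) ≤ ENNReal.ofReal σ →
      ∀ ε : ℝ, 0 < ε → ε < 1 → ∀ y₀ : ℝ,
      -- `x ↦ rk(x, N, M, y₀)` with `N = 60 log(4/ε)` and `M = 30` is a Markov kernel `T`
      (∃ T : ProbabilityTheory.Kernel ℝ ℝ, ProbabilityTheory.IsMarkovKernel T ∧
        (∀ x : ℝ, T x = RejectionKernel.rkLaw (RejectionKernel.signedKernel f θ₀ σ)
          (RejectionKernel.baseDensity σ) (60 * Real.log (4 / ε)) 30 y₀ x) ∧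
        -- the law of `rk(X_θ, N, M, y₀)` is close to `N(f(θ), σ²)`
        (∀ θ ∈ RejectionKernel.Θ,
          RejectionKernel.tvDist ((RejectionKernel.uniformSource θ).bind T)
              (RejectionKernel.gaussianTarget f σ θ) ≤
            ENNReal.ofReal (ε / 2) +
              10 * RejectionKernel.expTail σ (RejectionKernel.alpha1 f θ₀)) ∧
        -- the deficiency
        (10 * RejectionKernel.alpha1 f θ₀ * ENNReal.ofReal √(2 * Real.log (20 / ε)) ≤
            ENNReal.ofReal σ →
          RejectionKernel.deficiency
              (fun θ : RejectionKernel.Θ => RejectionKernel.uniformSource θ)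
              (fun θ : RejectionKernel.Θ => RejectionKernel.gaussianTarget f σ θ) T ≤
            ENNReal.ofReal ε)) ∧
      -- the running time, on every input and every random tape
      (∀ Tsamp Teval : ℝ, 1 ≤ Tsamp → 1 ≤ Teval → ∀ (x : ℝ) (ω : ℕ → ℝ × ℝ),
        RejectionKernel.rkTime (RejectionKernel.signedKernel f θ₀ σ)
            (RejectionKernel.baseDensity σ) (60 * Real.log (4 / ε)) 30 y₀ Tsamp Teval x ω ≤
          K * (Real.log (4 / ε) * (Tsamp + Teval))) := by
  open RejectionKernel in
  refine ⟨1000, by norm_num, fun f θ₀ hθ₀ hc hd σ hσ hα ε hε hε1 y₀ => ?_⟩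
  obtain ⟨h, hne⟩ := isRegular_of_alpha_le hθ₀ hc hd hσ hα
  have htail : expTail σ (alpha1 f θ₀) = ENNReal.ofReal (realTail σ (alpha1 f θ₀).toReal) := by
    rw [← expTail_ofReal hσ ENNReal.toReal_nonneg, ENNReal.ofReal_toReal hne]
  -- As `4/ε > e`, the additive constant in the running time is absorbed into the logarithm: `7(60 L
  -- + 3) ≤ 441 L` for `L ≥ 1`.
  have hlog : 1 ≤ Real.log (4 / ε) := by
    rw [Real.le_log_iff_exp_le (by positivity), le_div_iff₀ hε]
    nlinarith [Real.exp_one_lt_three, Real.exp_pos 1]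
  refine ⟨⟨h.rkKernel (60 * Real.log (4 / ε)) 30 y₀, h.isMarkovKernel_rkKernel _ _ _,
    fun x => rfl, fun θ hθ => ?_, fun hdef => iSup_le fun θ => ?_⟩,
    fun Tsamp Teval hs he x ω => ?_⟩
  · refine (h.tvDist_bind_rkKernel_le hε hε1 y₀ hθ).trans ?_
    rw [htail, ENNReal.ofReal_add (by positivity) (mul_nonneg (by norm_num) (realTail_nonneg _ _)),
      ENNReal.ofReal_mul (by norm_num), ENNReal.ofReal_ofNat]
  · rw [tvDist_comm]
    refine (h.tvDist_bind_rkKernel_le hε hε1 y₀ θ.2).trans (ENNReal.ofReal_le_ofReal ?_)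
    have h1 : 10 * (alpha1 f θ₀).toReal * √(2 * Real.log (20 / ε)) ≤ σ := by
      rw [← ENNReal.ofReal_le_ofReal_iff hσ.le, ENNReal.ofReal_mul (by positivity),
        ENNReal.ofReal_mul (by norm_num), ENNReal.ofReal_ofNat, ENNReal.ofReal_toReal hne]
      exact hdef
    linarith [ten_mul_realTail_le ENNReal.toReal_nonneg hε hε1 h1]
  · refine (rkTime_le _ _ 30 y₀ x ω (by positivity) hs he).trans ?_
    rw [← mul_assoc]
    refine mul_le_mul_of_nonneg_right ?_ (by linarith)
    linarith
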